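/- **Setting.** Consider the two-dimensional Ripa model $U_t+\nabla\cdot F(U)=S(U,b)$ for $U=(h,m,w,\eta)^T=(h,hu,hv,h\theta)^T$, with columns of $F$ equal to $(m,\ \tfrac{m^2}{h}+\tfrac12 g\eta h,\ \tfrac{mw}{h},\ \tfrac{m\eta}{h})^T$ and $(w,\ \tfrac{mw}{h},\ \tfrac{w^2}{h}+\tfrac12 g\eta h,\ \tfrac{w\eta}{h})^T$ and $S=(0,-g\eta b_x,-g\eta b_y,0)^T$. Let $\mathcal T_h^n$ and $\mathcal T_h^{n+1}$ be triangular meshes with the same connectivity, interior or periodic edges being shared by two elements and every other edge carrying reflecting or outflow conditions (outflow: exterior state equal to the interior state). Let $k\ge 1$ and let $\mathcal V_h^k$ be the space of functions whose restriction to each element lies in $\mathbb P^k$. A state $(U_h,b_h)=(h_h,m_h,w_h,\eta_h,b_h)$ with components in $\mathcal V_h^k$ is at *lake-at-rest* with constants $C_1,C_2>0$ if on every element $m_h=0$, $w_h=0$, $\eta_h=C_1h_h$ and $h_h+b_h=C_2$. A bar denotes a cell average. **One step of the moving mesh DG (MM-DG) method**, from $(U_h^n,b_h^n)$ on $\mathcal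 T_h^n$ to $(U_h^{n+1},\hat b_h^{n+1})$ on the (arbitrarily generated) mesh $\mathcal T_h^{n+1}$: 1. *Linear scaling positivity-preserving (PP) limiter.* Let $G_p$ be a fixed finite nonempty set of points of the reference element. On each element $q$ is replaced by $\hat q=\lambda_q(q-\bar q)+\bar q$ with $\lambda_q=\min\{1,\ \bar q/(\bar q-\min_{G_p}q)\}$ if $\bar q>0$ (read as $1$ if $\min_{G_p}q\ge\bar q$), and $\lambda_q=0$ if $\bar q\le 0$. 2. *Remapping.* Let $\mathcal T_h(\varsigma)$, $0\le\varsigma\le1$, be the linear interpolant (of the vertex positions) of the two meshes, with piecewise linear mesh velocity $\dot X$. $\mathrm{DGInterp}$ solves $\frac{d}{d\varsigma}\int_K q\phi\,dx=-\int_K q\,\dot X\cdot\nabla\phi\,dx-\sum_{e\subset\partial K}\int_e\hat G\,\phi\,ds$ for all $\phi\in\mathbb P^k(K)$ moving with the mesh, where $\hat G=\tfrac12\big(-(q^{int}+q^{ext})\dot X\cdot n-\alpha_e(q^{ext}-q^{int})\big)$, $\alpha_e=\max_e|\dot X\cdot n|$, and $q^{ext}=q^{int}$ on non-periodic boundary edges,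 by the SSP-RK3 scheme on a subdivision $0=\varsigma_0<\dots<\varsigma_N=1$, with stage times $\varsigma_\nu$, $\varsigma_{\nu+1}$, $\tfrac12(\varsigma_\nu+\varsigma_{\nu+1})$. The element volumes in the mass terms are updated by the same Runge–Kutta scheme applied to $\frac{d}{d\varsigma}|K|=\int_{\partial K}\dot X\cdot n\,ds$. $\mathrm{PP\text{-}DGInterp}$ applies in addition the PP limiter after each stage. Put $\tilde h=\mathrm{PP\text{-}DGInterp}(h_h^n)$, $\tilde\eta=\mathrm{PP\text{-}DGInterp}(\eta_h^n)$, $\tilde m=\mathrm{DGInterp}(m_h^n)$, $\tilde w=\mathrm{DGInterp}(w_h^n)$ and $b_h^{n+1}=\mathrm{DGInterp}(h_h^n+b_h^n)-\tilde h$. 3. *Time stepping on $\mathcal T_h^{n+1}$.* With $R^*_{h,K}(U,b,\phi)=\int_K S\phi\,dx+\int_K F(U)\cdot\nabla\phi\,dx-\sum_e\int_e\hat F^*\phi\,ds$, the three SSP-RK3 stages are $$\int_K U^{(i)}\phi\,dx=(1-a_i)\int_K\tilde U\phi\,dx+a_i\Big(\int_K U^{(i-1)}\phi\,dx+\Delta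 t\,R^*_{h,K}(U^{(i-1)},b^{(i-1)},\phi)\Big)\quad\forall\phi\in\mathbb P^k(K),$$ $a=(1,\tfrac14,\tfrac23)$, $(U^{(0)},b^{(0)})=(\tilde U,b_h^{n+1})$; here $(U^{(i-1)},b^{(i-1)})$ is the limited result of the preceding stage. The flux is $\hat F^*=\hat F(U^{int,*},U^{ext,*})+(F(U^{int})-F(U^{int,*}))\cdot n$, where $\hat F$ is the Lax–Friedrichs flux, with coefficient the maximal wave speed $|un_x+vn_y|+\sqrt{gh\theta}$ over the edge or over all elements, and $U^*$ is the hydrostatic reconstruction $h^{*}=\max(0,h+b-\max(b^{int},b^{ext}))$, $U^{*}=h^{*}\cdot(1,m/h,w/h,\eta/h)^T$. Velocities may be set to zero where $h$ is below a given tolerance; quotients with zero denominator are read as $0$. 4. *Limiting after each stage.* The characteristic-wise Cockburn–Shu TVB slope limiter is applied to $(h+b,m,w,\eta+(b\theta)_h)$ with $(b\theta)_h=(\bar\eta/\bar h)\,b_h$ on each element (a cell whose linear part the limiter does not change is left alone; otherwise the polynomials are replaced by the limited linear ones), and $h^{mod}=(h+b)^{mod}-b_h$, $\eta^{mod}=(\eta+(b\theta)_h)^{mod}-(b\theta)_h$.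 In the variant for nearly dry problems, troubled cells are detected by $h+b$, and $(h,m,w,\eta)$ is limited there. Then $h^{mod}$ and $\eta^{mod}$ are replaced by their PP-limited versions $\hat h^{mod}$, $\hat\eta^{mod}$, and $b_h$ by $\hat b_h=b_h-(\hat h^{mod}-h^{mod})$. **Assumptions.** All elements of $\mathcal T_h(\varsigma)$ are nondegenerate and positively oriented for $0\le\varsigma\le1$, and the pseudo-time steps are so small that the updated element volumes at the intermediate Runge–Kutta stages of the remapping are positive. **Theorem (well-balance of the full MM-DG step).** If $(U_h^n,b_h^n)$ is at lake-at-rest with constants $C_1,C_2>0$, then so is $(U_h^{n+1},\hat b_h^{n+1})$, with the same constants: its components lie in $\mathcal V_h^k$ on $\mathcal T_h^{n+1}$ and $m=w=0$, $\eta=C_1h$, $h+b=C_2$ on every element. Moreover, at each of the three Runge–Kutta stages and on every element the PP scaling factors of $h^{mod}$ and $\eta^{mod}$ agree: $\lambda_h=\lambda_\eta$. -/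

import Mathlib

namespace Ripa

noncomputable section

/-! ### Polynomials on the reference triangle

A discontinuous Galerkin function on a triangular mesh is stored element by element, as the
polynomial obtained by pulling its restriction to the element `K` back to the reference triangle by
the affine map `ξ ↦ p₀ + ξ₀ (p₁ - p₀) + ξ₁ (p₂ - p₀)`, where `p₀, p₁, p₂` are the corners of `K`. -/

abbrev Pt := Fin 2 → ℝ

abbrev Poly := MvPolynomial (Fin 2) ℝ

/-- Polynomials of total degree at most `k`. -/
abbrev Pk (k : ℕ) : Submodule ℝ Poly := MvPolynomial.restrictTotalDegree (Fin 2) ℝ k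

def refTriangle : Set Pt := {ξ | 0 ≤ ξ 0 ∧ 0 ≤ ξ 1 ∧ ξ 0 + ξ 1 ≤ 1}

def refIntegral (f : Pt → ℝ) : ℝ := ∫ ξ in refTriangle, f ξ

/-- Cell average (the reference triangle has area `1 / 2`). -/
def avg (q : Poly) : ℝ := 2 * refIntegral (fun ξ => MvPolynomial.eval ξ q)

/-- Barycentric coordinates. -/
def baryPoly : Fin 3 → Poly :=
  ![1 - MvPolynomial.X 0 - MvPolynomial.X 1, MvPolynomial.X 0, MvPolynomial.X 1]

def refCorner : Fin 3 → Pt := ![![0, 0], ![1, 0], ![0, 1]]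

/-- Edge `e` is opposite to corner `e` and runs from corner `e + 1` to corner `e + 2`
(indices mod 3); this is its parametrization by `s ∈ [0, 1]`. -/
def edgePt (e : Fin 3) (s : ℝ) : Pt := (1 - s) • refCorner (e + 1) + s • refCorner (e + 2)

open Classical in
/-- The element `r` of `P^k` with `∫_K r φ = ℓ φ` for all `φ` in `P^k`, on an element of
area `vol`. -/
def dgSolve (k : ℕ) (vol : ℝ) (ℓ : Poly → ℝ) : Poly :=
  if H : ∃ r ∈ Pk k, ∀ φ ∈ Pk k,
      2 * vol * refIntegral (fun ξ => MvPolynomial.eval ξ r * MvPolynomial.eval ξ φ) = ℓ φ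
  then H.choose else 0

/-! ### Geometry of a physical triangle with corners `p 0, p 1, p 2` (counterclockwise) -/

/-- Twice the signed area, the Jacobian of the map from the reference triangle. -/
def jac (p : Fin 3 → Pt) : ℝ :=
  (p 1 0 - p 0 0) * (p 2 1 - p 0 1) - (p 1 1 - p 0 1) * (p 2 0 - p 0 0)

def area (p : Fin 3 → Pt) : ℝ := jac p / 2

/-- `∫_K f dx`, for `f` given in reference coordinates. -/
def elemIntegral (p : Fin 3 → Pt) (f : Pt → ℝ) : ℝ := jac p * refIntegral f

/-- The physical partial derivatives `∂φ/∂x`, `∂φ/∂y`, in reference coordinates. -/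
def physGrad (p : Fin 3 → Pt) (φ : Poly) : Fin 2 → Poly :=
  ![((p 2 1 - p 0 1) / jac p) • MvPolynomial.pderiv 0 φ
      - ((p 1 1 - p 0 1) / jac p) • MvPolynomial.pderiv 1 φ,
    ((p 1 0 - p 0 0) / jac p) • MvPolynomial.pderiv 1 φ
      - ((p 2 0 - p 0 0) / jac p) • MvPolynomial.pderiv 0 φ]

def dot (a c : Pt) : ℝ := a 0 * c 0 + a 1 * c 1

def cross (a c : Pt) : ℝ := a 0 * c 1 - a 1 * c 0

/-- Euclidean length of a plane vector. -/
def len (a : Pt) : ℝ := Real.sqrt (dot a a)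

def edgeVec (p : Fin 3 → Pt) (e : Fin 3) : Pt := p (e + 2) - p (e + 1)

/-- Outward unit normal on edge `e`. -/
def normal (p : Fin 3 → Pt) (e : Fin 3) : Pt :=
  (len (edgeVec p e))⁻¹ • ![edgeVec p e 1, -edgeVec p e 0]

/-- `∫_e f ds`, for `f` given in terms of the edge parameter. -/
def edgeIntegral (p : Fin 3 → Pt) (e : Fin 3) (f : ℝ → ℝ) : ℝ :=
  len (edgeVec p e) * ∫ s in (0 : ℝ)..1, f s

def barycenter (p : Fin 3 → Pt) : Pt := (1 / 3 : ℝ) • (p 0 + p 1 + p 2)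

def edgeMid (p : Fin 3 → Pt) (e : Fin 3) : Pt := (1 / 2 : ℝ) • (p (e + 1) + p (e + 2))

/-- The length of the longest edge. -/
def diam (p : Fin 3 → Pt) : ℝ :=
  max (len (edgeVec p 0)) (max (len (edgeVec p 1)) (len (edgeVec p 2)))

/-! ### Meshes -/

/-- What lies on the other side of an edge: edge `e'` of the element `K'`, translated by `-τ`
(`τ = 0` for an interior edge, a period of the domain for periodic boundary conditions), or a
reflecting or outflow (zero-order extrapolation) part of the boundary of the domain. -/
inductive Link (T : Type*) where
  | adjacent (K' : T) (e' : Fin 3) (τ : Pt)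
  | reflecting
  | outflow

/-- Connectivity of a triangular mesh with vertices `V` and elements `T`. -/
structure MeshTopology (V T : Type*) where
  vert : T → Fin 3 → V
  link : T → Fin 3 → Link T
  link_symm : ∀ K e K' e' τ, link K e = Link.adjacent K' e' τ →
    link K' e' = Link.adjacent K e (-τ)

variable {V T : Type*}

/-- The corners of the element `K` when the vertices have the positions `x`. -/
def MeshTopology.tri (D : MeshTopology V T) (x : V → Pt) (K : T) : Fin 3 → Pt :=
  fun j => x (D.vert K j)

/-- The positions `x` make a triangular mesh with the connectivity `D`: the elements are
nondegenerate, with corners in counterclockwise order, and linked edges match. -/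
structure MeshTopology.IsMesh (D : MeshTopology V T) (x : V → Pt) : Prop where
  jac_pos : ∀ K, 0 < jac (D.tri x K)
  edge_match : ∀ K e K' e' τ, D.link K e = Link.adjacent K' e' τ →
    D.tri x K' (e' + 1) = D.tri x K (e + 2) + τ ∧ D.tri x K' (e' + 2) = D.tri x K (e + 1) + τ

/-- Interior trace of a DG function on edge `e` of `K`. -/
def intTrace (q : T → Poly) (K : T) (e : Fin 3) (s : ℝ) : ℝ :=
  MvPolynomial.eval (edgePt e s) (q K)

/-- Exterior trace; on the boundary of the domain the interior trace. -/
def MeshTopology.extTrace (D : MeshTopology V T) (q : T → Poly) (K : T) (e : Fin 3) (s : ℝ) : ℝ :=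
  match D.link K e with
  | Link.adjacent K' e' _ => intTrace q K' e' (1 - s)
  | Link.reflecting => intTrace q K e s
  | Link.outflow => intTrace q K e s

/-! ### Parameters of the method and discrete states -/

/-- Is the Lax-Friedrichs coefficient the maximal wave speed over the edge, or over all
elements? -/
inductive Viscosity where
  | perEdge
  | global

/-- `surface`: the TVB limiter acts on `(h + b, m, w, η + bθ)`.  `nearlyDry`: troubled cells are
found from `h + b` and `(h, m, w, η)` is limited there. -/
inductive TVBMode where
  | surface
  | nearlyDry

structure Scheme where
  /-- polynomial degree -/
  k : ℕ
  one_le_k : 1 ≤ k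
  /-- gravitational acceleration -/
  g : ℝ
  visc : Viscosity
  /-- optional depth below which the velocities are set to zero -/
  dryTol : Option ℝ
  tvbMode : TVBMode
  /-- the constant `M` of the TVB-modified minmod function -/
  tvbM : ℝ
  /-- the factor `ν` of the slope limiter -/
  tvbNu : ℝ
  /-- the points at which the positivity-preserving limiter acts, in reference coordinates -/
  G : Finset Pt
  G_nonempty : G.Nonempty

/-- The DG unknowns `U = (h, m, w, η)` and the DG bottom topography `b`. -/
structure Config (T : Type*) where
  U : Fin 4 → T → Poly
  b : T → Poly

/-- All components are piecewise polynomials of degree at most `k`. -/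
def Config.InDG (k : ℕ) (c : Config T) : Prop :=
  (∀ i K, c.U i K ∈ Pk k) ∧ ∀ K, c.b K ∈ Pk k

/-- `m = 0`, `w = 0`, `η = C₁ h`, `h + b = C₂` on every element. -/
structure Config.IsLakeAtRest (C₁ C₂ : ℝ) (c : Config T) : Prop where
  m_eq : ∀ K, c.U 1 K = 0
  w_eq : ∀ K, c.U 2 K = 0
  eta_eq : ∀ K, c.U 3 K = C₁ • c.U 0 K
  surface_eq : ∀ K, c.U 0 K + c.b K = MvPolynomial.C C₂

/-! ### Linear scaling positivity-preserving limiter -/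

/-- Scaling factor `min {1, q̄ / (q̄ - min_G q)}` for `q̄ > 0` (read as `1` if `q̄ ≤ min_G q`),
and `0` for `q̄ ≤ 0`. -/
def Scheme.ppFactor (S : Scheme) (q : Poly) : ℝ :=
  if avg q ≤ 0 then 0
  else if avg q ≤ S.G.inf' S.G_nonempty (fun ξ => MvPolynomial.eval ξ q) then 1
  else min 1 (avg q / (avg q - S.G.inf' S.G_nonempty (fun ξ => MvPolynomial.eval ξ q)))

def Scheme.ppScale (S : Scheme) (q : Poly) : Poly :=
  S.ppFactor q • (q - MvPolynomial.C (avg q)) + MvPolynomial.C (avg q)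

/-- The limiter on depth and temperature variable, with the high-order correction
`b - (ĥ - h)` of the bottom. -/
def Scheme.ppLimit (S : Scheme) (c : Config T) : Config T where
  U := ![fun K => S.ppScale (c.U 0 K), c.U 1, c.U 2, fun K => S.ppScale (c.U 3 K)]
  b := fun K => c.b K - (S.ppScale (c.U 0 K) - c.U 0 K)

/-! ### DG-interpolation between deforming meshes -/

/-- Position of the vertices of the moving mesh at pseudo-time `σ`. -/
def posAt (x₀ x₁ : V → Pt) (σ : ℝ) : V → Pt := fun v => (1 - σ) • x₀ v + σ • x₁ v

/-- The piecewise linear mesh deformation function at a point of an element, where `d j` is the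
displacement of corner `j`. -/
def meshVel (d : Fin 3 → Pt) (ξ : Pt) : Pt :=
  (1 - ξ 0 - ξ 1) • d 0 + ξ 0 • d 1 + ξ 1 • d 2

/-- Local Lax-Friedrichs flux for the flux function `-q Ẋ`. -/
def MeshTopology.interpFlux (D : MeshTopology V T) (x d : V → Pt) (q : T → Poly)
    (K : T) (e : Fin 3) (s : ℝ) : ℝ :=
  let vn : ℝ → ℝ := fun s => dot (meshVel (D.tri d K) (edgePt e s)) (normal (D.tri x K) e)
  let α : ℝ := sSup ((fun s => |vn s|) '' Set.Icc 0 1)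
  (1 / 2) * (-(intTrace q K e s + D.extTrace q K e s) * vn s
    - α * (D.extTrace q K e s - intTrace q K e s))

/-- Spatial operator of the semi-discrete scheme `d/dς ∫_K q φ = A(q, φ)` on the mesh with vertex
positions `x` and displacements `d`. -/
def MeshTopology.interpRhs (D : MeshTopology V T) (x d : V → Pt) (q : T → Poly)
    (K : T) (φ : Poly) : ℝ :=
  -elemIntegral (D.tri x K) (fun ξ => MvPolynomial.eval ξ (q K) *
      dot (meshVel (D.tri d K) ξ) (fun j => MvPolynomial.eval ξ (physGrad (D.tri x K) φ j)))
    - ∑ e : Fin 3, edgeIntegral (D.tri x K) e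
        (fun s => D.interpFlux x d q K e s * intTrace (fun _ => φ) K e s)

/-- Rate of change `∫_{∂K} Ẋ · n ds` of the volume of an element. -/
def MeshTopology.volRate (D : MeshTopology V T) (x d : V → Pt) (K : T) : ℝ :=
  ∑ e : Fin 3, edgeIntegral (D.tri x K) e
    (fun s => dot (meshVel (D.tri d K) (edgePt e s)) (normal (D.tri x K) e))

/-- A subdivision `0 = ς 0 < ς 1 < ⋯ < ς N = 1` of the pseudo-time interval. -/
structure PseudoTime where
  N : ℕ
  ς : ℕ → ℝ
  start : ς 0 = 0
  finish : ς N = 1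
  increasing : ∀ ν < N, ς ν < ς (ν + 1)

/-! Element volumes at the three Runge-Kutta stages of a pseudo-time step from `σ` to `σ + δ`,
updated by the Runge-Kutta scheme itself (geometric conservation law). -/

def MeshTopology.stageVol₁ (D : MeshTopology V T) (x₀ x₁ : V → Pt) (σ δ : ℝ) (K : T) : ℝ :=
  area (D.tri (posAt x₀ x₁ σ) K) + δ * D.volRate (posAt x₀ x₁ σ) (x₁ - x₀) K

def MeshTopology.stageVol₂ (D : MeshTopology V T) (x₀ x₁ : V → Pt) (σ δ : ℝ) (K : T) : ℝ :=
  3 / 4 * area (D.tri (posAt x₀ x₁ σ) K)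
    + 1 / 4 * (D.stageVol₁ x₀ x₁ σ δ K + δ * D.volRate (posAt x₀ x₁ (σ + δ)) (x₁ - x₀) K)

def MeshTopology.stageVol₃ (D : MeshTopology V T) (x₀ x₁ : V → Pt) (σ δ : ℝ) (K : T) : ℝ :=
  1 / 3 * area (D.tri (posAt x₀ x₁ σ) K)
    + 2 / 3 * (D.stageVol₂ x₀ x₁ σ δ K + δ * D.volRate (posAt x₀ x₁ (σ + δ / 2)) (x₁ - x₀) K)

/-- The moving mesh is not tangled, and the pseudo-time steps are so small that the updated element
volumes at the intermediate stages are positive. -/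
structure MeshTopology.Admissible (D : MeshTopology V T) (x₀ x₁ : V → Pt) (P : PseudoTime) :
    Prop where
  not_tangled : ∀ σ ∈ Set.Icc (0 : ℝ) 1, D.IsMesh (posAt x₀ x₁ σ)
  vol₁_pos : ∀ ν < P.N, ∀ K, 0 < D.stageVol₁ x₀ x₁ (P.ς ν) (P.ς (ν + 1) - P.ς ν) K
  vol₂_pos : ∀ ν < P.N, ∀ K, 0 < D.stageVol₂ x₀ x₁ (P.ς ν) (P.ς (ν + 1) - P.ς ν) K

/-- `∫_K q φ` on an element of volume `vol`. -/
def massForm (vol : ℝ) (q φ : Poly) : ℝ :=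
  2 * vol * refIntegral (fun ξ => MvPolynomial.eval ξ q * MvPolynomial.eval ξ φ)

/-- One SSP-RK3 step from pseudo-time `σ` to `σ + δ`; `post` is applied on each element after each
stage. -/
def MeshTopology.interpStep (D : MeshTopology V T) (k : ℕ) (post : Poly → Poly)
    (x₀ x₁ : V → Pt) (σ δ : ℝ) (q : T → Poly) : T → Poly :=
  let d : V → Pt := x₁ - x₀
  let vol₀ : T → ℝ := fun K => area (D.tri (posAt x₀ x₁ σ) K)
  let q₁ : T → Poly := fun K => post (dgSolve k (D.stageVol₁ x₀ x₁ σ δ K) fun φ =>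
    massForm (vol₀ K) (q K) φ + δ * D.interpRhs (posAt x₀ x₁ σ) d q K φ)
  let q₂ : T → Poly := fun K => post (dgSolve k (D.stageVol₂ x₀ x₁ σ δ K) fun φ =>
    3 / 4 * massForm (vol₀ K) (q K) φ
      + 1 / 4 * (massForm (D.stageVol₁ x₀ x₁ σ δ K) (q₁ K) φ
        + δ * D.interpRhs (posAt x₀ x₁ (σ + δ)) d q₁ K φ))
  fun K => post (dgSolve k (D.stageVol₃ x₀ x₁ σ δ K) fun φ =>
    1 / 3 * massForm (vol₀ K) (q K) φ
      + 2 / 3 * (massForm (D.stageVol₂ x₀ x₁ σ δ K) (q₂ K) φ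
        + δ * D.interpRhs (posAt x₀ x₁ (σ + δ / 2)) d q₂ K φ))

def MeshTopology.interpIter (D : MeshTopology V T) (k : ℕ) (post : Poly → Poly)
    (x₀ x₁ : V → Pt) (P : PseudoTime) (q : T → Poly) : ℕ → T → Poly
  | 0 => q
  | ν + 1 => D.interpStep k post x₀ x₁ (P.ς ν) (P.ς (ν + 1) - P.ς ν)
      (D.interpIter k post x₀ x₁ P q ν)

/-- DG-interpolation from the mesh `x₀` to the mesh `x₁`. -/
def MeshTopology.dgInterp (D : MeshTopology V T) (S : Scheme) (x₀ x₁ : V → Pt) (P : PseudoTime)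
    (q : T → Poly) : T → Poly :=
  D.interpIter S.k id x₀ x₁ P q P.N

/-- DG-interpolation with the linear scaling positivity-preserving limiter. -/
def MeshTopology.ppDgInterp (D : MeshTopology V T) (S : Scheme) (x₀ x₁ : V → Pt) (P : PseudoTime)
    (q : T → Poly) : T → Poly :=
  D.interpIter S.k S.ppScale x₀ x₁ P q P.N

/-- The remapping step for all variables. -/
def MeshTopology.remap (D : MeshTopology V T) (S : Scheme) (x₀ x₁ : V → Pt) (P : PseudoTime)
    (c : Config T) : Config T where
  U := ![D.ppDgInterp S x₀ x₁ P (c.U 0), D.dgInterp S x₀ x₁ P (c.U 1),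
    D.dgInterp S x₀ x₁ P (c.U 2), D.ppDgInterp S x₀ x₁ P (c.U 3)]
  b := D.dgInterp S x₀ x₁ P (c.U 0 + c.b) - D.ppDgInterp S x₀ x₁ P (c.U 0)

/-! ### The Ripa model and its well-balanced DG discretization

Point values are vectors `U = (h, m, w, η)`. -/

/-- The velocity `(u, v) = (m / h, w / h)`, set to zero below the dry tolerance if there is one. -/
def Scheme.vel (S : Scheme) (U : Fin 4 → ℝ) : Pt :=
  match S.dryTol with
  | none => ![U 1 / U 0, U 2 / U 0]
  | some ε => if U 0 < ε then 0 else ![U 1 / U 0, U 2 / U 0]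

/-- The two columns of the flux function `F(U)`. -/
def Scheme.flux (S : Scheme) (U : Fin 4 → ℝ) : Fin 2 → Fin 4 → ℝ :=
  ![![U 1, S.vel U 0 * U 1 + 1 / 2 * S.g * U 3 * U 0, S.vel U 0 * U 2, S.vel U 0 * U 3],
    ![U 2, S.vel U 1 * U 1, S.vel U 1 * U 2 + 1 / 2 * S.g * U 3 * U 0, S.vel U 1 * U 3]]

/-- `F(U) · n`. -/
def Scheme.fluxN (S : Scheme) (n : Pt) (U : Fin 4 → ℝ) (i : Fin 4) : ℝ :=
  S.flux U 0 i * n 0 + S.flux U 1 i * n 1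

/-- Largest absolute value `|u n_x + v n_y| + √(g h θ)` of the eigenvalues of `F'(U) · n`. -/
def Scheme.waveSpeed (S : Scheme) (n : Pt) (U : Fin 4 → ℝ) : ℝ :=
  |dot (S.vel U) n| + Real.sqrt (S.g * U 0 * (U 3 / U 0))

/-- Mirror image of a state at a wall with unit normal `n`. -/
def mirror (n : Pt) (U : Fin 4 → ℝ) : Fin 4 → ℝ :=
  ![U 0, U 1 - 2 * (U 1 * n 0 + U 2 * n 1) * n 0, U 2 - 2 * (U 1 * n 0 + U 2 * n 1) * n 1, U 3]

def intState (U : Fin 4 → T → Poly) (K : T) (e : Fin 3) (s : ℝ) : Fin 4 → ℝ :=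
  fun i => intTrace (U i) K e s

def MeshTopology.extState (D : MeshTopology V T) (x : V → Pt) (U : Fin 4 → T → Poly)
    (K : T) (e : Fin 3) (s : ℝ) : Fin 4 → ℝ :=
  match D.link K e with
  | Link.adjacent K' e' _ => intState U K' e' (1 - s)
  | Link.reflecting => mirror (normal (D.tri x K) e) (intState U K e s)
  | Link.outflow => intState U K e s

/-- Hydrostatic reconstruction of a trace `U` with bottom trace `b`, where `bs` is the larger of the
two bottom traces. -/
def Scheme.reconst (S : Scheme) (U : Fin 4 → ℝ) (b bs : ℝ) : Fin 4 → ℝ :=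
  let hs := max 0 (U 0 + b - bs)
  ![hs, hs * S.vel U 0, hs * S.vel U 1, hs * (U 3 / U 0)]

def MeshTopology.bStar (D : MeshTopology V T) (c : Config T) (K : T) (e : Fin 3) (s : ℝ) : ℝ :=
  max (intTrace c.b K e s) (D.extTrace c.b K e s)

def MeshTopology.intStar (D : MeshTopology V T) (S : Scheme) (c : Config T)
    (K : T) (e : Fin 3) (s : ℝ) : Fin 4 → ℝ :=
  S.reconst (intState c.U K e s) (intTrace c.b K e s) (D.bStar c K e s)

def MeshTopology.extStar (D : MeshTopology V T) (S : Scheme) (x : V → Pt) (c : Config T)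
    (K : T) (e : Fin 3) (s : ℝ) : Fin 4 → ℝ :=
  S.reconst (D.extState x c.U K e s) (D.extTrace c.b K e s) (D.bStar c K e s)

def MeshTopology.edgeSpeed (D : MeshTopology V T) (S : Scheme) (x : V → Pt) (c : Config T)
    (K : T) (e : Fin 3) : ℝ :=
  sSup ((fun s => max (S.waveSpeed (normal (D.tri x K) e) (D.intStar S c K e s))
    (S.waveSpeed (normal (D.tri x K) e) (D.extStar S x c K e s))) '' Set.Icc 0 1)

/-- The Lax-Friedrichs coefficient. -/
def MeshTopology.lfCoeff (D : MeshTopology V T) (S : Scheme) (x : V → Pt) (c : Config T)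
    (K : T) (e : Fin 3) : ℝ :=
  match S.visc with
  | Viscosity.perEdge => D.edgeSpeed S x c K e
  | Viscosity.global => sSup (Set.range fun Ke : T × Fin 3 => D.edgeSpeed S x c Ke.1 Ke.2)

def Scheme.lfFlux (S : Scheme) (α : ℝ) (n : Pt) (Ui Ue : Fin 4 → ℝ) (i : Fin 4) : ℝ :=
  (1 / 2) * (S.fluxN n Ui i + S.fluxN n Ue i - α * (Ue i - Ui i))

/-- The well-balanced numerical flux. -/
def MeshTopology.wbFlux (D : MeshTopology V T) (S : Scheme) (x : V → Pt) (c : Config T)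
    (K : T) (e : Fin 3) (s : ℝ) (i : Fin 4) : ℝ :=
  let n := normal (D.tri x K) e
  S.lfFlux (D.lfCoeff S x c K e) n (D.intStar S c K e s) (D.extStar S x c K e s) i
    + (S.fluxN n (intState c.U K e s) i - S.fluxN n (D.intStar S c K e s) i)

/-- The source term `(0, -g η b_x, -g η b_y, 0)` at a reference point of `K`. -/
def MeshTopology.source (D : MeshTopology V T) (S : Scheme) (x : V → Pt) (c : Config T)
    (K : T) (ξ : Pt) : Fin 4 → ℝ :=
  ![0,
    -S.g * MvPolynomial.eval ξ (c.U 3 K)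
      * MvPolynomial.eval ξ (physGrad (D.tri x K) (c.b K) 0),
    -S.g * MvPolynomial.eval ξ (c.U 3 K)
      * MvPolynomial.eval ξ (physGrad (D.tri x K) (c.b K) 1),
    0]

/-- The residual `∫_K S φ + ∫_K F · ∇φ - ∑_e ∫_e F̂* φ`, component `i`. -/
def MeshTopology.residual (D : MeshTopology V T) (S : Scheme) (x : V → Pt) (c : Config T)
    (K : T) (i : Fin 4) (φ : Poly) : ℝ :=
  elemIntegral (D.tri x K) (fun ξ => D.source S x c K ξ i * MvPolynomial.eval ξ φ)
    + elemIntegral (D.tri x K) (fun ξ => S.fluxN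
        (fun j => MvPolynomial.eval ξ (physGrad (D.tri x K) φ j))
        (fun l => MvPolynomial.eval ξ (c.U l K)) i)
    - ∑ e : Fin 3, edgeIntegral (D.tri x K) e
        (fun s => D.wbFlux S x c K e s i * intTrace (fun _ => φ) K e s)

/-- A Runge-Kutta stage
`∫ U φ = (1 - a) ∫ Ũ φ + a (∫ U' φ + Δt R(U', b', φ))`, where `base = (Ũ, b̃)` and
`prev = (U', b')`. -/
def MeshTopology.rkStage (D : MeshTopology V T) (S : Scheme) (x : V → Pt) (dt a : ℝ)
    (base prev : Config T) : Config T where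
  U := fun i K => dgSolve S.k (area (D.tri x K)) fun φ =>
    (1 - a) * massForm (area (D.tri x K)) (base.U i K) φ
      + a * (massForm (area (D.tri x K)) (prev.U i K) φ + dt * D.residual S x prev K i φ)
  b := prev.b

/-! ### Characteristic TVB slope limiter on triangles -/

/-- `L²` projection onto linear polynomials. -/
def p1Part (q : Poly) : Poly :=
  dgSolve 1 (1 / 2) fun φ =>
    refIntegral (fun ξ => MvPolynomial.eval ξ q * MvPolynomial.eval ξ φ)

def minmod (a d : ℝ) : ℝ :=
  if 0 < a ∧ 0 < d then min a d else if a < 0 ∧ d < 0 then max a d else 0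

/-- TVB-modified minmod with threshold `M (Δx)²`. -/
def tvbMinmod (threshold a d : ℝ) : ℝ := if |a| ≤ threshold then a else minmod a d

/-- Barycenter of the neighbour across edge `e`; on the boundary of the domain, of the mirror image
of `K`. -/
def MeshTopology.nbrBary (D : MeshTopology V T) (x : V → Pt) (K : T) (e : Fin 3) : Pt :=
  match D.link K e with
  | Link.adjacent K' _ τ => barycenter (D.tri x K') - τ
  | _ => barycenter (D.tri x K) + (2 * dot (edgeMid (D.tri x K) e - barycenter (D.tri x K))
      (normal (D.tri x K) e)) • normal (D.tri x K) e

/-- Cell averages of `(W₀, …, W₃)` in the neighbour across edge `e`; the components 1 and 2 are those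
of a vector and are mirrored at a wall. -/
def MeshTopology.nbrAvg (D : MeshTopology V T) (x : V → Pt) (W : Fin 4 → T → Poly)
    (K : T) (e : Fin 3) : Fin 4 → ℝ :=
  match D.link K e with
  | Link.adjacent K' _ _ => fun l => avg (W l K')
  | Link.reflecting => mirror (normal (D.tri x K) e) fun l => avg (W l K)
  | Link.outflow => fun l => avg (W l K)

/-- The coefficients `(α, β)` with `m_e - B = α (B_e - B) + β (B_j - B)`, where `m_e` is the midpoint
of edge `e`, `B` the barycenter of `K` and `B_e`, `B_j` those of the neighbours across the edges `e`
and `j`. -/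
def MeshTopology.slopeCoeff (D : MeshTopology V T) (x : V → Pt) (K : T) (e j : Fin 3) : ℝ × ℝ :=
  let B := barycenter (D.tri x K)
  let r := edgeMid (D.tri x K) e - B
  let a := D.nbrBary x K e - B
  let c := D.nbrBary x K j - B
  (cross r c / cross a c, cross a r / cross a c)

open Classical in
/-- The second neighbour used at edge `e`, chosen so that the coefficients are nonnegative. -/
def MeshTopology.secondNbr (D : MeshTopology V T) (x : V → Pt) (K : T) (e : Fin 3) : Fin 3 :=
  if cross (D.nbrBary x K e - barycenter (D.tri x K))
        (D.nbrBary x K (e + 1) - barycenter (D.tri x K)) ≠ 0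
      ∧ 0 ≤ (D.slopeCoeff x K e (e + 1)).1 ∧ 0 ≤ (D.slopeCoeff x K e (e + 1)).2
  then e + 1 else e + 2

/-- The increment from the barycenter to the midpoint of edge `e` predicted by the averages in the
neighbours. -/
def MeshTopology.nbrSlope (D : MeshTopology V T) (x : V → Pt) (W : Fin 4 → T → Poly)
    (K : T) (e : Fin 3) (l : Fin 4) : ℝ :=
  let j := D.secondNbr x K e
  (D.slopeCoeff x K e j).1 * (D.nbrAvg x W K e l - avg (W l K))
    + (D.slopeCoeff x K e j).2 * (D.nbrAvg x W K j l - avg (W l K))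

/-- The increment of the linear part of a polynomial from the barycenter to the midpoint of
edge `e`. -/
def ownSlope (q : Poly) (e : Fin 3) : ℝ :=
  MvPolynomial.eval (edgePt e (1 / 2)) (p1Part q) - avg q

open Classical in
/-- Right eigenvectors (columns) of `F'(U) · n`, with `c = √(g h θ)`; the identity where they do not
form a basis. -/
def Scheme.eigMatrix (S : Scheme) (n : Pt) (U : Fin 4 → ℝ) : Matrix (Fin 4) (Fin 4) ℝ :=
  let u := S.vel U 0
  let v := S.vel U 1
  let θ := U 3 / U 0
  let c := Real.sqrt (S.g * U 0 * θ)
  let R : Matrix (Fin 4) (Fin 4) ℝ :=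
    !![1, 0, 1, 1;
       u - c * n 0, -n 1, u, u + c * n 0;
       v - c * n 1, n 0, v, v + c * n 1;
       θ, 0, -θ, θ]
  if R.det ≠ 0 then R else 1

/-- Limited increments at the midpoint of edge `e`, computed in the local characteristic variables
given by the mean of `U` in `K` and the direction from the barycenter to the midpoint. -/
def MeshTopology.charSlope (D : MeshTopology V T) (S : Scheme) (x : V → Pt)
    (U W : Fin 4 → T → Poly) (K : T) (e : Fin 3) : Fin 4 → ℝ :=
  let r := edgeMid (D.tri x K) e - barycenter (D.tri x K)
  let R := S.eigMatrix ((len r)⁻¹ • r) fun l => avg (U l K)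
  let own := R⁻¹.mulVec fun l => ownSlope (W l K) e
  let nbr := R⁻¹.mulVec fun l => D.nbrSlope x W K e l
  R.mulVec fun l => tvbMinmod (S.tvbM * diam (D.tri x K) ^ 2) (own l) (S.tvbNu * nbr l)

/-- Correction that makes the three increments sum to zero. -/
def balance (Δ : Fin 3 → ℝ) (e : Fin 3) : ℝ :=
  let pos := ∑ j, max 0 (Δ j)
  let neg := ∑ j, max 0 (-Δ j)
  if ∑ j, Δ j = 0 then Δ e
  else min 1 (neg / pos) * max 0 (Δ e) - min 1 (pos / neg) * max 0 (-Δ e)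

/-- The linear polynomial with mean `a` and the given increments at the edge midpoints, after the
correction. -/
def linearFrom (a : ℝ) (Δ : Fin 3 → ℝ) : Poly :=
  MvPolynomial.C a + ∑ e, balance Δ e • (1 - (2 : ℝ) • baryPoly e)

def MeshTopology.charLimited (D : MeshTopology V T) (S : Scheme) (x : V → Pt)
    (U W : Fin 4 → T → Poly) (l : Fin 4) (K : T) : Poly :=
  linearFrom (avg (W l K)) fun e => D.charSlope S x U W K e l

/-- Scalar TVB limiter applied to the component `l` of `W`. -/
def MeshTopology.scalarLimited (D : MeshTopology V T) (S : Scheme) (x : V → Pt)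
    (W : Fin 4 → T → Poly) (l : Fin 4) (K : T) : Poly :=
  linearFrom (avg (W l K)) fun e =>
    tvbMinmod (S.tvbM * diam (D.tri x K) ^ 2) (ownSlope (W l K) e)
      (S.tvbNu * D.nbrSlope x W K e l)

/-- `(bθ)_h = (η̄ / h̄) b_h` on each element. -/
def bTheta (c : Config T) (K : T) : Poly := (avg (c.U 3 K) / avg (c.U 0 K)) • c.b K

/-- `(h + b, m, w, η + bθ)`. -/
def surfaceVars (c : Config T) : Fin 4 → T → Poly :=
  ![fun K => c.U 0 K + c.b K, c.U 1, c.U 2, fun K => c.U 3 K + bTheta c K]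

open Classical in
/-- The limiter based on `(h + b, m, w, η + bθ)`: a cell whose linear part is not changed by
limiting is left alone, otherwise the limited linear part is taken; `b` and `bθ` are subtracted
afterwards. -/
def MeshTopology.tvbSurface (D : MeshTopology V T) (S : Scheme) (x : V → Pt) (c : Config T) :
    Config T :=
  let W := surfaceVars c
  let Wmod : Fin 4 → T → Poly := fun l K =>
    if ∀ i, D.charLimited S x c.U W i K = p1Part (W i K) then W l K
    else D.charLimited S x c.U W l K
  { U := ![fun K => Wmod 0 K - c.b K, Wmod 1, Wmod 2, fun K => Wmod 3 K - bTheta c K]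
    b := c.b }

open Classical in
/-- The variant for nearly dry problems. -/
def MeshTopology.tvbNearlyDry (D : MeshTopology V T) (S : Scheme) (x : V → Pt) (c : Config T) :
    Config T where
  U := fun l K =>
    if D.scalarLimited S x (surfaceVars c) 0 K = p1Part (surfaceVars c 0 K) then c.U l K
    else D.charLimited S x c.U c.U l K
  b := c.b

def MeshTopology.tvbLimit (D : MeshTopology V T) (S : Scheme) (x : V → Pt) (c : Config T) :
    Config T :=
  match S.tvbMode with
  | TVBMode.surface => D.tvbSurface S x c
  | TVBMode.nearlyDry => D.tvbNearlyDry S x c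

/-! ### The full step -/

/-- SSP-RK3 on the mesh `x` from the state `c`, with TVB and positivity-preserving limiting after
each stage: the states at the three stages after the TVB limiter and before the
positivity-preserving limiter. -/
def MeshTopology.rkMod (D : MeshTopology V T) (S : Scheme) (x : V → Pt) (dt : ℝ)
    (c : Config T) : Fin 3 → Config T :=
  let c₁ := D.tvbLimit S x (D.rkStage S x dt 1 c c)
  let c₂ := D.tvbLimit S x (D.rkStage S x dt (1 / 4) c (S.ppLimit c₁))
  let c₃ := D.tvbLimit S x (D.rkStage S x dt (2 / 3) c (S.ppLimit c₂))
  ![c₁, c₂, c₃]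

/-- One step of the rezoning moving mesh DG method, from `(U^n, b^n)` on the mesh `x₀` to
`(U^{n+1}, b^{n+1})` on the mesh `x₁`. -/
def MeshTopology.mmdgStep (D : MeshTopology V T) (S : Scheme) (x₀ x₁ : V → Pt) (P : PseudoTime)
    (dt : ℝ) (c : Config T) : Config T :=
  S.ppLimit (D.rkMod S x₁ dt (D.remap S x₀ x₁ P c) 2)

end

end Ripa

/-!
The step leaves a lake at rest exactly where the remapping puts it: after the remapping neither the
time stepping nor any of the limiters changes the state.

*Remapping.* The spatial operator of the DG-interpolation is homogeneous in `q`, and so is the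
positivity-preserving limiter (`ppScale_smul`). The local problems have unique solutions, since the
mass form is definite (`dgSolve_eq`). Hence `η = C₁ h` is inherited by the remapped variables. On a
constant, the divergence theorem on a triangle (`jac_mul_refInt_physGrad`) turns the operator into
the mass form with the rate of change of the volume as weight (`interpRhs_const`). As the volumes
are updated by the same Runge-Kutta scheme, constants are preserved at each stage. The area of an
element is quadratic in pseudo-time and is integrated exactly (`stageVol₃_eq`), so the volume of the
last stage is the actual one and the next pseudo-time step starts consistently. Thus `h + b`, `m`
and `w` stay constant, and the remapped state is again a lake at rest. Its depth is moreover a fixed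
point of the limiter, which is idempotent (`ppScale_ppScale`) and acts last in the interpolation.
This is needed below: a Runge-Kutta stage averages the depth with that of the preceding stage but
keeps the bottom of the preceding stage, so a limiter that changed the depth would destroy
`h + b = C₂`.

*Time stepping.* At a lake at rest the hydrostatic reconstructions from the two sides of an edge
agree, and the numerical flux reduces to the pressure flux of the interior trace (`wbFlux_lake`).
With `∇b = -∇h` the residual is the defect in the divergence theorem for `½ g C₁ h² φ`, which is
zero (`pressure_balance`). So each stage reproduces its input.

*Limiting.* On each element the variables handled by the slope limiter are constant
(`surfaceVars_lake`), so its increments vanish regardless of the neighbouring averages. The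
positivity-preserving limiter does nothing because the depth is a fixed point of it and `η = C₁ h`.
The scaling factors agree because they are invariant under multiplication by `C₁ > 0`
(`ppFactor_smul`).
-/

namespace Ripa

open MeasureTheory MvPolynomial

variable {V T : Type*}

/-! ### Integration of polynomials over the reference triangle -/

theorem measurableSet_refTriangle : MeasurableSet refTriangle := by
  apply MeasurableSet.inter
  · exact measurableSet_le measurable_const (measurable_pi_apply 0)
  apply MeasurableSet.inter
  · exact measurableSet_le measurable_const (measurable_pi_apply 1)
  · exact measurableSet_le ((measurable_pi_apply 0).add (measurable_pi_apply 1)) measurable_const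

theorem refTriangle_subset_Icc : refTriangle ⊆ Set.Icc 0 1 := by
  rintro ξ ⟨h0, h1, h2⟩
  constructor <;> intro i <;> fin_cases i <;> simp <;> linarith

theorem integrableOn_refTriangle {f : Pt → ℝ} (hf : Continuous f) :
    IntegrableOn f refTriangle :=
  (hf.continuousOn.integrableOn_compact isCompact_Icc).mono_set refTriangle_subset_Icc

theorem continuous_evalPt (q : Poly) : Continuous fun ξ : Pt => eval ξ q :=
  MvPolynomial.continuous_eval q

/-- Fubini's theorem on the reference triangle, the second coordinate being integrated first. -/
theorem refIntegral_eq_integral_integral {f : Pt → ℝ} (hf : Continuous f) :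
    refIntegral f = ∫ x in (0 : ℝ)..1, ∫ y in (0 : ℝ)..(1 - x), f ![x, y] := by
  have hmp := (volume_preserving_finTwoArrow ℝ).symm
  have h1 : refIntegral f = ∫ z : ℝ × ℝ, refTriangle.indicator f ![z.1, z.2] := by
    rw [refIntegral, ← integral_indicator measurableSet_refTriangle,
      ← hmp.integral_comp (MeasurableEquiv.measurableEmbedding _)]
    rfl
  have hint : Integrable (fun z : ℝ × ℝ => refTriangle.indicator f ![z.1, z.2])
      (volume.prod volume) := by
    have := (integrableOn_refTriangle hf).integrable_indicator measurableSet_refTriangle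
    rw [← hmp.integrable_comp_emb (MeasurableEquiv.measurableEmbedding _)] at this
    exact this
  rw [h1, Measure.volume_eq_prod, integral_prod _ hint,
    intervalIntegral.integral_of_le zero_le_one, ← integral_Icc_eq_integral_Ioc,
    ← integral_indicator measurableSet_Icc]
  congr 1
  ext x
  by_cases hx : x ∈ Set.Icc (0 : ℝ) 1
  · rw [Set.indicator_of_mem hx, intervalIntegral.integral_of_le (by linarith [hx.2]),
      ← integral_Icc_eq_integral_Ioc, ← integral_indicator measurableSet_Icc]
    congr 1
    ext y
    have : ![x, y] ∈ refTriangle ↔ y ∈ Set.Icc (0 : ℝ) (1 - x) := by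
      simp only [refTriangle, Set.mem_ofPred_eq, Matrix.cons_val_zero, Matrix.cons_val_one,
        Set.mem_Icc]
      constructor
      · rintro ⟨_, h, h'⟩
        exact ⟨h, by linarith⟩
      · rintro ⟨h, h'⟩
        exact ⟨hx.1, h, by linarith⟩
    by_cases hy : y ∈ Set.Icc (0 : ℝ) (1 - x)
    · rw [Set.indicator_of_mem hy, Set.indicator_of_mem (this.2 hy)]
    · rw [Set.indicator_of_notMem hy, Set.indicator_of_notMem (this.not.2 hy)]
  · rw [Set.indicator_of_notMem hx]
    have : ∀ y, refTriangle.indicator f ![x, y] = 0 := by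
      intro y
      apply Set.indicator_of_notMem
      rintro ⟨h0, h1, h2⟩
      simp only [Matrix.cons_val_zero, Matrix.cons_val_one] at h0 h1 h2
      exact hx ⟨h0, by linarith⟩
    simp [this]

/-- The reference triangle is invariant under exchanging the coordinates. -/
theorem refIntegral_swap (f : Pt → ℝ) :
    refIntegral (fun ξ => f ![ξ 1, ξ 0]) = refIntegral f := by
  have hmp := volume_measurePreserving_piCongrLeft (fun _ : Fin 2 => ℝ) (Equiv.swap 0 1)
  have he : ∀ ξ : Pt, MeasurableEquiv.piCongrLeft (fun _ : Fin 2 => ℝ) (Equiv.swap 0 1) ξ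
      = ![ξ 1, ξ 0] := by
    intro ξ
    ext i
    rw [MeasurableEquiv.coe_piCongrLeft, Equiv.piCongrLeft_apply]
    fin_cases i <;> simp
  have hpre : (MeasurableEquiv.piCongrLeft (fun _ : Fin 2 => ℝ) (Equiv.swap 0 1)) ⁻¹' refTriangle
      = refTriangle := by
    ext ξ
    rw [Set.mem_preimage, he]
    simp only [refTriangle, Set.mem_ofPred_eq, Matrix.cons_val_zero, Matrix.cons_val_one,
      add_comm (ξ 1)]
    tauto
  have := hmp.setIntegral_preimage_emb (MeasurableEquiv.measurableEmbedding _) f refTriangle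
  rw [hpre] at this
  simp only [he] at this
  exact this

/-- Integration over the reference triangle as a linear functional on polynomials. -/
noncomputable def refInt : Poly →ₗ[ℝ] ℝ where
  toFun q := refIntegral fun ξ => eval ξ q
  map_add' p q := by
    simp only [refIntegral, map_add]
    exact integral_add (integrableOn_refTriangle (continuous_evalPt p))
      (integrableOn_refTriangle (continuous_evalPt q))
  map_smul' a q := by
    simp only [refIntegral, smul_eval, RingHom.id_apply, smul_eq_mul]
    exact integral_const_mul _ _

theorem refIntegral_eval (q : Poly) : refIntegral (fun ξ => eval ξ q) = refInt q := rfl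

theorem continuous_edgePt (e : Fin 3) : Continuous (edgePt e) := by
  unfold edgePt
  fun_prop

theorem continuous_eval_edgePt (e : Fin 3) (q : Poly) :
    Continuous fun s => eval (edgePt e s) q :=
  (continuous_evalPt q).comp (continuous_edgePt e)

/-- Integration of the trace on an edge of the reference triangle over the edge parameter. -/
noncomputable def edgeInt (e : Fin 3) : Poly →ₗ[ℝ] ℝ where
  toFun q := ∫ s in (0 : ℝ)..1, eval (edgePt e s) q
  map_add' p q := by
    simp only [map_add]
    exact intervalIntegral.integral_add ((continuous_eval_edgePt e p).intervalIntegrable _ _)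
      ((continuous_eval_edgePt e q).intervalIntegrable _ _)
  map_smul' a q := by
    simp only [smul_eval, RingHom.id_apply, smul_eq_mul]
    exact intervalIntegral.integral_const_mul _ _

theorem integral_eval_edgePt (e : Fin 3) (q : Poly) :
    ∫ s in (0 : ℝ)..1, eval (edgePt e s) q = edgeInt e q := rfl

/-! ### The divergence theorem on a triangle -/

theorem hasDerivAt_eval_update (q : Poly) (ξ : Pt) (i : Fin 2) (t : ℝ) :
    HasDerivAt (fun t => eval (Function.update ξ i t) q)
      (eval (Function.update ξ i t) (pderiv i q)) t := by
  induction q using MvPolynomial.induction_on with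
  | C a => simpa using hasDerivAt_const t a
  | add p q hp hq => simpa using hp.fun_add hq
  | mul_X p j hp =>
    by_cases hj : j = i
    · subst hj
      simpa [pderiv_X_self, add_comm, mul_comm] using hp.fun_mul (hasDerivAt_id t)
    · simpa [pderiv_X_of_ne (Ne.symm hj), Function.update_of_ne hj, pderiv_X_of_ne hj, mul_comm]
        using hp.mul_const (ξ j)

theorem integral_pderiv_one (q : Poly) (x a c : ℝ) :
    ∫ y in a..c, eval ![x, y] (pderiv 1 q) = eval ![x, c] q - eval ![x, a] q := by
  have hu : ∀ y, Function.update ![x, 0] 1 y = ![x, y] := by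
    intro y; ext i; fin_cases i <;> simp
  refine intervalIntegral.integral_eq_sub_of_hasDerivAt (f := fun y => eval ![x, y] q)
    (fun y _ => ?_) (Continuous.intervalIntegrable ?_ _ _)
  · simpa only [hu] using hasDerivAt_eval_update q ![x, 0] 1 y
  · exact (continuous_evalPt _).comp (by fun_prop)

theorem integral_pderiv_zero (q : Poly) (y a c : ℝ) :
    ∫ x in a..c, eval ![x, y] (pderiv 0 q) = eval ![c, y] q - eval ![a, y] q := by
  have hu : ∀ x, Function.update ![0, y] 0 x = ![x, y] := by
    intro y; ext i; fin_cases i <;> simp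
  refine intervalIntegral.integral_eq_sub_of_hasDerivAt (f := fun x => eval ![x, y] q)
    (fun x _ => ?_) (Continuous.intervalIntegrable ?_ _ _)
  · simpa only [hu] using hasDerivAt_eval_update q ![0, y] 0 x
  · exact (continuous_evalPt _).comp (by fun_prop)

theorem edgePt_zero (s : ℝ) : edgePt 0 s = ![1 - s, s] := by
  ext i; fin_cases i <;> simp [edgePt, refCorner]

theorem edgePt_one (s : ℝ) : edgePt 1 s = ![0, 1 - s] := by
  ext i; fin_cases i <;> simp [edgePt, refCorner]

theorem edgePt_two (s : ℝ) : edgePt 2 s = ![s, 0] := by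
  have h : (2 + 1 : Fin 3) = 0 := rfl
  have h' : (2 + 2 : Fin 3) = 1 := rfl
  ext i; fin_cases i <;> simp [edgePt, refCorner, h, h']

theorem integral_comp_one_sub (f : ℝ → ℝ) :
    ∫ s in (0 : ℝ)..1, f (1 - s) = ∫ s in (0 : ℝ)..1, f s := by
  simp [intervalIntegral.integral_comp_sub_left]

theorem refInt_pderiv_one (q : Poly) : refInt (pderiv 1 q) = edgeInt 0 q - edgeInt 2 q := by
  rw [← refIntegral_eval, refIntegral_eq_integral_integral (continuous_evalPt _)]
  simp only [integral_pderiv_one]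
  rw [intervalIntegral.integral_sub]
  · congr 1
    · rw [← integral_eval_edgePt, ← integral_comp_one_sub]
      simp [edgePt_zero]
    · simp [← integral_eval_edgePt, edgePt_two]
  all_goals
    apply Continuous.intervalIntegrable
    exact (continuous_evalPt _).comp (by fun_prop)

theorem refInt_pderiv_zero (q : Poly) : refInt (pderiv 0 q) = edgeInt 0 q - edgeInt 1 q := by
  have hc : Continuous fun ξ : Pt => eval ![ξ 1, ξ 0] (pderiv 0 q) :=
    (continuous_evalPt _).comp (by fun_prop)
  rw [← refIntegral_eval, ← refIntegral_swap, refIntegral_eq_integral_integral hc]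
  simp only [Matrix.cons_val_zero, Matrix.cons_val_one, integral_pderiv_zero]
  rw [intervalIntegral.integral_sub]
  · congr 1
    · simp [← integral_eval_edgePt, edgePt_zero]
    · rw [← integral_eval_edgePt, ← integral_comp_one_sub]
      simp [edgePt_one]
  all_goals
    apply Continuous.intervalIntegrable
    exact (continuous_evalPt _).comp (by fun_prop)

theorem refInt_one : refInt 1 = 1 / 2 := by
  rw [← refIntegral_eval, refIntegral_eq_integral_integral (continuous_evalPt _)]
  simp only [map_one, intervalIntegral.integral_const, smul_eq_mul, mul_one, sub_zero]
  rw [integral_comp_one_sub (fun s => s), integral_id]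
  norm_num

theorem refInt_C (a : ℝ) : refInt (C a) = a / 2 := by
  rw [← mul_one (C a), C_mul', map_smul, refInt_one, smul_eq_mul]
  ring

/-- The outward normal of edge `e` scaled by the length of the edge. -/
def scaledNormal (p : Fin 3 → Pt) (e : Fin 3) : Pt := ![edgeVec p e 1, -edgeVec p e 0]

theorem len_eq_zero {a : Pt} (h : len a = 0) : a = 0 := by
  have h' : dot a a ≤ 0 := Real.sqrt_eq_zero'.1 h
  unfold dot at h'
  ext i
  fin_cases i <;> simp <;> nlinarith [mul_self_nonneg (a 0), mul_self_nonneg (a 1)]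

theorem len_mul_normal (p : Fin 3 → Pt) (e : Fin 3) (i : Fin 2) :
    len (edgeVec p e) * normal p e i = scaledNormal p e i := by
  unfold normal scaledNormal
  by_cases h : len (edgeVec p e) = 0
  · rw [h, zero_mul, len_eq_zero h]
    fin_cases i <;> simp
  · rw [Pi.smul_apply, smul_eq_mul, mul_inv_cancel_left₀ h]

/-- The divergence theorem on a triangle: `∫_K ∂q/∂x_i dx = ∑_e ∫_e q n_i ds`. -/
theorem jac_mul_refInt_physGrad {p : Fin 3 → Pt} (hp : jac p ≠ 0) (q : Poly) (i : Fin 2) :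
    jac p * refInt (physGrad p q i) = ∑ e, scaledNormal p e i * edgeInt e q := by
  have h20 : (2 + 1 : Fin 3) = 0 := rfl
  have h21 : (2 + 2 : Fin 3) = 1 := rfl
  have h12 : (1 + 2 : Fin 3) = 0 := rfl
  have h11 : (1 + 1 : Fin 3) = 2 := rfl
  fin_cases i <;>
    simp only [physGrad, Fin.zero_eta, Fin.mk_one, Matrix.cons_val_zero, Matrix.cons_val_one,
      map_sub, map_smul, refInt_pderiv_zero, refInt_pderiv_one, smul_eq_mul, Fin.sum_univ_three,
      scaledNormal, edgeVec, h20, h21, h12, h11, zero_add, Pi.sub_apply] <;>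
    field_simp <;> ring

theorem physGrad_mul (p : Fin 3 → Pt) (q r : Poly) (i : Fin 2) :
    physGrad p (q * r) i = physGrad p q i * r + q * physGrad p r i := by
  fin_cases i <;>
    simp [physGrad, MvPolynomial.smul_eq_C_mul] <;> ring

/-- Integration by parts on a triangle. -/
theorem integration_by_parts {p : Fin 3 → Pt} (hp : jac p ≠ 0) (q r : Poly) (i : Fin 2) :
    jac p * refInt (physGrad p q i * r) + jac p * refInt (q * physGrad p r i)
      = ∑ e, scaledNormal p e i * edgeInt e (q * r) := by
  rw [← jac_mul_refInt_physGrad hp, physGrad_mul, map_add, mul_add]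

/-! ### The mass form and the local solves -/

theorem massForm_eq (vol : ℝ) (q φ : Poly) : massForm vol q φ = 2 * vol * refInt (q * φ) := by
  simp only [massForm, ← refIntegral_eval, map_mul]

theorem eq_zero_of_refInt_mul_self {q : Poly} (h : refInt (q * q) = 0) : q = 0 := by
  have hc : Continuous fun ξ : Pt => eval ξ (q * q) := continuous_evalPt _
  have h0 : (fun ξ : Pt => eval ξ (q * q)) =ᵐ[volume.restrict refTriangle] 0 := by
    refine (setIntegral_eq_zero_iff_of_nonneg_ae (Filter.Eventually.of_forall fun ξ => ?_)
      (integrableOn_refTriangle hc)).1 h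
    simpa using mul_self_nonneg _
  -- the square `(1/3, 1/2) × (1/3, 1/2)` lies in the triangle
  let s : Fin 2 → Set ℝ := fun _ => Set.Ioo (1 / 3) (1 / 2)
  have hs : Set.pi Set.univ s ⊆ refTriangle := by
    intro ξ hξ
    have h0 := hξ 0 trivial
    have h1 := hξ 1 trivial
    simp only [s, Set.mem_Ioo] at h0 h1
    exact ⟨by linarith, by linarith, by linarith⟩
  have hopen : IsOpen (Set.pi Set.univ s) := isOpen_set_pi Set.finite_univ fun _ _ => isOpen_Ioo
  have heq := Measure.eqOn_open_of_ae_eq (ae_restrict_of_ae_restrict_of_subset hs h0) hopen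
    hc.continuousOn continuousOn_const
  have hinf : ∀ i, (s i).Infinite := fun i => Set.Ioo_infinite (by norm_num)
  refine MvPolynomial.funext_set s hinf fun ξ hξ => ?_
  have := heq hξ
  simpa using this

theorem massForm_sub_left (vol : ℝ) (q r φ : Poly) :
    massForm vol (q - r) φ = massForm vol q φ - massForm vol r φ := by
  simp only [massForm_eq, sub_mul, map_sub]
  ring

theorem massForm_smul_left (vol a : ℝ) (q φ : Poly) :
    massForm vol (a • q) φ = a * massForm vol q φ := by
  simp only [massForm_eq, smul_mul_assoc, map_smul, smul_eq_mul]
  ring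

theorem massForm_vol (a c : ℝ) (q φ : Poly) : massForm (a * c) q φ = a * massForm c q φ := by
  simp only [massForm_eq]
  ring

theorem massForm_vol_add (a c : ℝ) (q φ : Poly) :
    massForm (a + c) q φ = massForm a q φ + massForm c q φ := by
  simp only [massForm_eq]
  ring

theorem C_mem_Pk (k : ℕ) (a : ℝ) : C a ∈ Pk k := by
  simp [MvPolynomial.mem_restrictTotalDegree]

theorem dgSolve_mem (k : ℕ) (vol : ℝ) (ℓ : Poly → ℝ) : dgSolve k vol ℓ ∈ Pk k := by
  unfold dgSolve
  split_ifs with H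
  · exact H.choose_spec.1
  · exact Submodule.zero_mem _

/-- The mass form is definite on elements of nonzero area, so that a local problem has at most one
solution. -/
theorem dgSolve_eq {k : ℕ} {vol : ℝ} (hvol : vol ≠ 0) {ℓ : Poly → ℝ} {r : Poly} (hr : r ∈ Pk k)
    (h : ∀ φ ∈ Pk k, massForm vol r φ = ℓ φ) : dgSolve k vol ℓ = r := by
  have H : ∃ r ∈ Pk k, ∀ φ ∈ Pk k,
      2 * vol * refIntegral (fun ξ => MvPolynomial.eval ξ r * MvPolynomial.eval ξ φ) = ℓ φ :=
    ⟨r, hr, h⟩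
  rw [dgSolve, dif_pos H]
  obtain ⟨hmem, hsol⟩ := H.choose_spec
  have hd : H.choose - r ∈ Pk k := Submodule.sub_mem _ hmem hr
  have h0 : massForm vol (H.choose - r) (H.choose - r) = 0 := by
    rw [massForm_sub_left, h _ hd, sub_eq_zero]
    exact hsol _ hd
  rw [massForm_eq] at h0
  exact sub_eq_zero.1 (eq_zero_of_refInt_mul_self
    ((mul_eq_zero.1 h0).resolve_left (mul_ne_zero two_ne_zero hvol)))

theorem dgSolve_smul {k : ℕ} {vol a : ℝ} (hvol : vol ≠ 0) (ha : a ≠ 0) {ℓ ℓ' : Poly → ℝ}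
    (h : ∀ φ, ℓ' φ = a * ℓ φ) : dgSolve k vol ℓ' = a • dgSolve k vol ℓ := by
  by_cases H : ∃ r ∈ Pk k, ∀ φ ∈ Pk k, massForm vol r φ = ℓ φ
  · obtain ⟨r, hr, hsol⟩ := H
    rw [dgSolve_eq hvol hr hsol]
    refine dgSolve_eq hvol (Submodule.smul_mem _ _ hr) fun φ hφ => ?_
    rw [massForm_smul_left, hsol φ hφ, h]
  · have H' : ¬ ∃ r ∈ Pk k, ∀ φ ∈ Pk k, massForm vol r φ = ℓ' φ := by
      rintro ⟨r, hr, hsol⟩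
      refine H ⟨a⁻¹ • r, Submodule.smul_mem _ _ hr, fun φ hφ => ?_⟩
      rw [massForm_smul_left, hsol φ hφ, h, inv_mul_cancel_left₀ ha]
    have e : dgSolve k vol ℓ = 0 := dif_neg H
    have e' : dgSolve k vol ℓ' = 0 := dif_neg H'
    rw [e, e', smul_zero]

/-! ### The positivity-preserving limiter -/

theorem avg_eq (q : Poly) : avg q = 2 * refInt q := rfl

theorem avg_C (a : ℝ) : avg (C a) = a := by
  rw [avg_eq, refInt_C]
  ring

theorem avg_smul (a : ℝ) (q : Poly) : avg (a • q) = a * avg q := by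
  simp only [avg_eq, map_smul, smul_eq_mul]
  ring

theorem avg_ppScale (S : Scheme) (q : Poly) : avg (S.ppScale q) = avg q := by
  have : avg (C (avg q)) = avg q := avg_C _
  simp only [avg_eq, Scheme.ppScale, map_add, map_smul, map_sub, smul_eq_mul] at this ⊢
  rw [mul_add, mul_left_comm, mul_sub, this]
  ring

theorem ppScale_mem (S : Scheme) {k : ℕ} {q : Poly} (hq : q ∈ Pk k) : S.ppScale q ∈ Pk k :=
  Submodule.add_mem _ (Submodule.smul_mem _ _ (Submodule.sub_mem _ hq (C_mem_Pk k _)))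
    (C_mem_Pk k _)

/-- The minimum over the limiter points. -/
noncomputable def Scheme.ptMin (S : Scheme) (q : Poly) : ℝ :=
  S.G.inf' S.G_nonempty fun ξ => eval ξ q

theorem ptMin_smul (S : Scheme) {a : ℝ} (ha : 0 ≤ a) (q : Poly) :
    S.ptMin (a • q) = a * S.ptMin q := by
  have hm : Monotone fun t : ℝ => a * t := fun _ _ h => mul_le_mul_of_nonneg_left h ha
  unfold Scheme.ptMin
  rw [Finset.apply_inf'_eq_inf'_comp S.G_nonempty (fun t : ℝ => a * t) hm.map_inf]
  simp

theorem ppFactor_eq (S : Scheme) (q : Poly) : S.ppFactor q =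
    if avg q ≤ 0 then 0 else if avg q ≤ S.ptMin q then 1
    else min 1 (avg q / (avg q - S.ptMin q)) := rfl

theorem ppFactor_nonneg (S : Scheme) (q : Poly) : 0 ≤ S.ppFactor q := by
  rw [ppFactor_eq]
  split_ifs with h1 h2
  · exact le_rfl
  · exact zero_le_one
  · exact le_min zero_le_one (div_nonneg (by linarith) (by linarith))

theorem ptMin_ppScale (S : Scheme) (q : Poly) :
    S.ptMin (S.ppScale q) = S.ppFactor q * (S.ptMin q - avg q) + avg q := by
  have hm : Monotone fun t : ℝ => S.ppFactor q * (t - avg q) + avg q := fun _ _ h => by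
    have := mul_le_mul_of_nonneg_left h (ppFactor_nonneg S q)
    simp only
    linarith
  unfold Scheme.ptMin
  rw [Finset.apply_inf'_eq_inf'_comp S.G_nonempty
    (fun t : ℝ => S.ppFactor q * (t - avg q) + avg q) hm.map_inf]
  simp [Scheme.ppScale]

/-- The scaling factor depends only on the ratio of the minimum to the average. -/
theorem ppFactor_smul (S : Scheme) {a : ℝ} (ha : 0 < a) (q : Poly) :
    S.ppFactor (a • q) = S.ppFactor q := by
  have h1 : a * avg q ≤ 0 ↔ avg q ≤ 0 := by
    constructor <;> intro h <;> nlinarith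
  rw [ppFactor_eq, ppFactor_eq, ptMin_smul S ha.le, avg_smul, ← mul_sub,
    mul_div_mul_left _ _ ha.ne']
  simp only [h1, mul_le_mul_iff_right₀ ha]

theorem ppScale_smul (S : Scheme) {a : ℝ} (ha : 0 < a) (q : Poly) :
    S.ppScale (a • q) = a • S.ppScale q := by
  unfold Scheme.ppScale
  rw [ppFactor_smul S ha, avg_smul]
  simp only [MvPolynomial.smul_eq_C_mul, C_mul]
  ring

/-- Limiting twice is limiting once: the limited polynomial has a nonnegative minimum, or is a
nonpositive constant. -/
theorem ppScale_ppScale (S : Scheme) (q : Poly) : S.ppScale (S.ppScale q) = S.ppScale q := by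
  by_cases h0 : avg q ≤ 0
  · have h1 : S.ppFactor q = 0 := by rw [ppFactor_eq, if_pos h0]
    have h2 : S.ppScale q = C (avg q) := by rw [Scheme.ppScale, h1, zero_smul, zero_add]
    rw [h2, Scheme.ppScale, avg_C, sub_self, smul_zero, zero_add]
  · suffices h : S.ppFactor (S.ppScale q) = 1 by
      rw [Scheme.ppScale, h, one_smul, sub_add_cancel]
    have hmin : 0 ≤ S.ptMin (S.ppScale q) := by
      rw [ptMin_ppScale, ppFactor_eq, if_neg h0]
      split_ifs with h1
      · linarith
      · have hpos : 0 < avg q - S.ptMin q := by linarith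
        have := mul_le_mul_of_nonneg_right
          (min_le_right 1 (avg q / (avg q - S.ptMin q))) hpos.le
        rw [div_mul_cancel₀ _ hpos.ne'] at this
        linarith
    rw [ppFactor_eq, avg_ppScale, if_neg h0]
    split_ifs with h1
    · rfl
    · apply min_eq_left
      rw [le_div_iff₀ (by linarith)]
      linarith

/-- A limited polynomial with zero average vanishes. -/
theorem eq_zero_of_ppScale_eq {S : Scheme} {q : Poly} (hq : S.ppScale q = q) (h : avg q = 0) :
    q = 0 := by
  rw [← hq, Scheme.ppScale, ppFactor_eq, if_pos h.le, h]
  simp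

/-! ### The moving mesh and the geometric conservation law -/

theorem elemIntegral_eval (p : Fin 3 → Pt) (q : Poly) :
    elemIntegral p (fun ξ => eval ξ q) = jac p * refInt q := rfl

theorem edgeIntegral_const_mul (p : Fin 3 → Pt) (e : Fin 3) (a : ℝ) (f : ℝ → ℝ) :
    edgeIntegral p e (fun s => a * f s) = a * edgeIntegral p e f := by
  simp only [edgeIntegral, intervalIntegral.integral_const_mul]
  ring

theorem elemIntegral_const_mul (p : Fin 3 → Pt) (a : ℝ) (f : Pt → ℝ) :
    elemIntegral p (fun ξ => a * f ξ) = a * elemIntegral p f := by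
  simp only [elemIntegral, refIntegral, integral_const_mul]
  ring

/-- `∫_e v · n ds` for a polynomial vector field `v`. -/
theorem edgeIntegral_dot_normal (p : Fin 3 → Pt) (e : Fin 3) (v : Fin 2 → Poly) :
    edgeIntegral p e (fun s => dot (fun i => eval (edgePt e s) (v i)) (normal p e))
      = ∑ i, scaledNormal p e i * edgeInt e (v i) := by
  have h : (fun s => dot (fun i => eval (edgePt e s) (v i)) (normal p e))
      = fun s => eval (edgePt e s) (normal p e 0 • v 0 + normal p e 1 • v 1) := by
    ext s
    simp only [dot, map_add, smul_eval]
    ring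
  rw [h, edgeIntegral, integral_eval_edgePt]
  simp only [Fin.sum_univ_two, ← len_mul_normal, map_add, map_smul, smul_eq_mul]
  ring

/-- The components of the mesh deformation function as linear polynomials. -/
noncomputable def velPoly (d : Fin 3 → Pt) (i : Fin 2) : Poly := ∑ j, d j i • baryPoly j

theorem eval_velPoly (d : Fin 3 → Pt) (ξ : Pt) (i : Fin 2) :
    eval ξ (velPoly d i) = meshVel d ξ i := by
  simp only [velPoly, meshVel, Fin.sum_univ_three, baryPoly, map_add, smul_eval, Pi.add_apply,
    Pi.smul_apply, smul_eq_mul, Matrix.cons_val_zero, Matrix.cons_val_one, Matrix.cons_val_two,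
    Matrix.tail_cons, Matrix.head_cons, map_sub, map_one, eval_X]
  ring

theorem meshVel_eq (d : Fin 3 → Pt) (ξ : Pt) :
    meshVel d ξ = fun i => eval ξ (velPoly d i) := by
  ext i
  rw [eval_velPoly]

theorem meshVel_edgePt (d : Fin 3 → Pt) (e : Fin 3) (s : ℝ) :
    meshVel d (edgePt e s) = (1 - s) • d (e + 1) + s • d (e + 2) := by
  have h20 : (2 + 1 : Fin 3) = 0 := rfl
  have h21 : (2 + 2 : Fin 3) = 1 := rfl
  have h12 : (1 + 2 : Fin 3) = 0 := rfl
  have h11 : (1 + 1 : Fin 3) = 2 := rfl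
  ext i
  fin_cases e <;>
    simp [edgePt_zero, edgePt_one, edgePt_two, meshVel, h20, h21, h12, h11]
  all_goals ring

theorem edgeInt_velPoly (d : Fin 3 → Pt) (e : Fin 3) (i : Fin 2) :
    edgeInt e (velPoly d i) = (d (e + 1) i + d (e + 2) i) / 2 := by
  rw [← integral_eval_edgePt]
  simp only [eval_velPoly, meshVel_edgePt, Pi.add_apply, Pi.smul_apply, smul_eq_mul]
  rw [intervalIntegral.integral_add, intervalIntegral.integral_mul_const,
    intervalIntegral.integral_mul_const, integral_comp_one_sub (fun s => s), integral_id]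
  · norm_num
    ring
  all_goals
    apply Continuous.intervalIntegrable
    fun_prop

theorem physGrad_velPoly (p d : Fin 3 → Pt) (i j : Fin 2) :
    ∃ a, physGrad p (velPoly d i) j = C a := by
  have h (l : Fin 2) : ∃ a, pderiv l (velPoly d i) = C a := by
    refine ⟨d 0 i * -1 + d (l.succ) i, ?_⟩
    fin_cases l <;>
      simp [velPoly, Fin.sum_univ_three, baryPoly,
        MvPolynomial.smul_eq_C_mul]
  obtain ⟨a, ha⟩ := h 0
  obtain ⟨c, hc⟩ := h 1
  fin_cases j <;>
    simp only [physGrad, ha, hc, MvPolynomial.smul_eq_C_mul, ← C_mul, ← C_sub, Fin.zero_eta,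
      Fin.mk_one, Matrix.cons_val_zero, Matrix.cons_val_one] <;>
    exact ⟨_, rfl⟩

theorem edgeIntegral_meshVel_mul (p d : Fin 3 → Pt) (e : Fin 3) (φ : Poly) :
    edgeIntegral p e (fun s => dot (meshVel d (edgePt e s)) (normal p e) * eval (edgePt e s) φ)
      = ∑ i, scaledNormal p e i * edgeInt e (velPoly d i * φ) := by
  rw [← edgeIntegral_dot_normal p e fun i => velPoly d i * φ]
  congr 1
  ext s
  simp only [meshVel_eq, dot, map_mul]
  ring

theorem volRate_eq (D : MeshTopology V T) (x d : V → Pt) (K : T) :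
    D.volRate x d K = ∑ e, ∑ i, scaledNormal (D.tri x K) e i *
      ((D.tri d K (e + 1) i + D.tri d K (e + 2) i) / 2) := by
  refine Finset.sum_congr rfl fun e _ => ?_
  simp only [meshVel_eq, edgeIntegral_dot_normal, edgeInt_velPoly]

/-- The divergence of the mesh velocity is the constant `|K|' / |K|`, so that
`∫_{∂K} φ Ẋ · n ds - ∫_K Ẋ · ∇φ dx = |K|' / |K| ∫_K φ dx`. -/
theorem sum_edgeIntegral_meshVel_mul (D : MeshTopology V T) {x : V → Pt} (d : V → Pt) {K : T}
    (hK : jac (D.tri x K) ≠ 0) (φ : Poly) :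
    ∑ e, edgeIntegral (D.tri x K) e (fun s =>
        dot (meshVel (D.tri d K) (edgePt e s)) (normal (D.tri x K) e) * eval (edgePt e s) φ)
      = jac (D.tri x K) * refInt (∑ i, velPoly (D.tri d K) i * physGrad (D.tri x K) φ i)
        + massForm (D.volRate x d K) 1 φ := by
  obtain ⟨a, ha⟩ := physGrad_velPoly (D.tri x K) (D.tri d K) 0 0
  obtain ⟨c, hc⟩ := physGrad_velPoly (D.tri x K) (D.tri d K) 1 1
  have key : ∀ ψ : Poly, ∑ e, edgeIntegral (D.tri x K) e (fun s =>
        dot (meshVel (D.tri d K) (edgePt e s)) (normal (D.tri x K) e) * eval (edgePt e s) ψ)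
      = jac (D.tri x K) * refInt (∑ i, velPoly (D.tri d K) i * physGrad (D.tri x K) ψ i)
        + jac (D.tri x K) * (a + c) * refInt ψ := by
    intro ψ
    simp only [edgeIntegral_meshVel_mul]
    rw [Finset.sum_comm]
    simp only [← integration_by_parts hK, Fin.sum_univ_two, ha, hc, C_mul', map_add, map_smul,
      smul_eq_mul]
    ring
  have hvol : D.volRate x d K = jac (D.tri x K) * (a + c) / 2 := by
    have h1 := key 1
    have hg : ∀ i, physGrad (D.tri x K) 1 i = 0 := by
      intro i
      fin_cases i <;> simp [physGrad]
    simp only [map_one, mul_one, hg, mul_zero, Finset.sum_const_zero, map_zero, zero_add,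
      refInt_one] at h1
    rw [MeshTopology.volRate, h1]
    ring
  rw [key, hvol, massForm_eq, one_mul]
  ring

theorem extTrace_const (D : MeshTopology V T) (a : ℝ) (K : T) (e : Fin 3) (s : ℝ) :
    D.extTrace (fun _ => C a) K e s = a := by
  unfold MeshTopology.extTrace
  split <;> simp [intTrace]

theorem intTrace_const (a : ℝ) (K : T) (e : Fin 3) (s : ℝ) :
    intTrace (fun _ => C a) K e s = a := by
  simp [intTrace]

/-- On a constant the jump terms vanish, and the spatial operator reproduces the change of
volume. -/
theorem interpRhs_const (D : MeshTopology V T) {x : V → Pt} (d : V → Pt) {K : T}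
    (hK : jac (D.tri x K) ≠ 0) (a : ℝ) (φ : Poly) :
    D.interpRhs x d (fun _ => C a) K φ = massForm (D.volRate x d K) (C a) φ := by
  have hflux : ∀ e s, D.interpFlux x d (fun _ => C a) K e s * intTrace (fun _ => φ) K e s
      = -a * (dot (meshVel (D.tri d K) (edgePt e s)) (normal (D.tri x K) e)
        * eval (edgePt e s) φ) := by
    intro e s
    simp only [MeshTopology.interpFlux, extTrace_const, intTrace_const]
    simp only [intTrace]
    ring
  have hvol : (fun ξ => eval ξ (C a) * dot (meshVel (D.tri d K) ξ)
        (fun j => eval ξ (physGrad (D.tri x K) φ j)))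
      = fun ξ => a * eval ξ (∑ i, velPoly (D.tri d K) i * physGrad (D.tri x K) φ i) := by
    ext ξ
    simp only [meshVel_eq, dot, eval_C, Fin.sum_univ_two, map_add, map_mul]
  have hm : massForm (D.volRate x d K) (C a) φ = a * massForm (D.volRate x d K) 1 φ := by
    rw [← massForm_smul_left, MvPolynomial.smul_eq_C_mul, mul_one]
  simp only [MeshTopology.interpRhs, hflux, edgeIntegral_const_mul, hvol, elemIntegral_const_mul,
    elemIntegral_eval, ← Finset.mul_sum, sum_edgeIntegral_meshVel_mul D d hK, hm]
  ring

/-- The area of an element is a quadratic polynomial in pseudo-time, which the SSP-RK3 scheme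
integrates exactly (by Simpson's rule). -/
theorem stageVol₃_eq (D : MeshTopology V T) (x₀ x₁ : V → Pt) (σ δ : ℝ) (K : T) :
    D.stageVol₃ x₀ x₁ σ δ K = area (D.tri (posAt x₀ x₁ (σ + δ)) K) := by
  have h20 : (2 + 1 : Fin 3) = 0 := rfl
  have h21 : (2 + 2 : Fin 3) = 1 := rfl
  have h12 : (1 + 2 : Fin 3) = 0 := rfl
  have h11 : (1 + 1 : Fin 3) = 2 := rfl
  simp only [MeshTopology.stageVol₃, MeshTopology.stageVol₂, MeshTopology.stageVol₁, volRate_eq,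
    area, jac, MeshTopology.tri, posAt, scaledNormal, edgeVec, Fin.sum_univ_three,
    Fin.sum_univ_two, Matrix.cons_val_zero, Matrix.cons_val_one, Pi.sub_apply, Pi.add_apply,
    Pi.smul_apply, smul_eq_mul, h20, h21, h12, h11, zero_add]
  ring

/-! ### DG-interpolation between the meshes -/

theorem extTrace_smul (D : MeshTopology V T) (a : ℝ) (q : T → Poly) (K : T) (e : Fin 3) (s : ℝ) :
    D.extTrace (a • q) K e s = a * D.extTrace q K e s := by
  unfold MeshTopology.extTrace
  split <;> simp [intTrace]

theorem interpRhs_smul (D : MeshTopology V T) (x d : V → Pt) (a : ℝ) (q : T → Poly) (K : T)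
    (φ : Poly) : D.interpRhs x d (a • q) K φ = a * D.interpRhs x d q K φ := by
  have hflux : ∀ e s, D.interpFlux x d (a • q) K e s * intTrace (fun _ => φ) K e s
      = a * (D.interpFlux x d q K e s * intTrace (fun _ => φ) K e s) := by
    intro e s
    simp only [MeshTopology.interpFlux, extTrace_smul]
    simp only [intTrace, Pi.smul_apply, smul_eval]
    ring
  have hvol : ∀ r : Poly, ∀ v w : Pt → Pt,
      (fun ξ => eval ξ (a • r) * dot (v ξ) (w ξ)) = fun ξ => a * (eval ξ r * dot (v ξ) (w ξ)) := by
    intro r v w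
    ext ξ
    rw [smul_eval, mul_assoc]
  simp only [MeshTopology.interpRhs, hflux, edgeIntegral_const_mul, Pi.smul_apply, hvol,
    elemIntegral_const_mul, ← Finset.mul_sum]
  ring

theorem interpStep_mem (D : MeshTopology V T) {k : ℕ} {post : Poly → Poly}
    (hpost : ∀ q ∈ Pk k, post q ∈ Pk k) (x₀ x₁ : V → Pt) (σ δ : ℝ) (q : T → Poly) (K : T) :
    D.interpStep k post x₀ x₁ σ δ q K ∈ Pk k :=
  hpost _ (dgSolve_mem _ _ _)

theorem interpIter_mem (D : MeshTopology V T) {k : ℕ} {post : Poly → Poly}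
    (hpost : ∀ q ∈ Pk k, post q ∈ Pk k) (x₀ x₁ : V → Pt) (P : PseudoTime) {q : T → Poly}
    (hq : ∀ K, q K ∈ Pk k) (ν : ℕ) (K : T) : D.interpIter k post x₀ x₁ P q ν K ∈ Pk k := by
  cases ν with
  | zero => exact hq K
  | succ ν => exact interpStep_mem D hpost _ _ _ _ _ _

/-- One pseudo-time step commutes with multiplication by a nonzero scalar, provided that `post`
does. -/
theorem interpStep_smul (D : MeshTopology V T) (k : ℕ) {post : Poly → Poly} {a : ℝ} (ha : a ≠ 0)
    (hpost : ∀ q, post (a • q) = a • post q) (x₀ x₁ : V → Pt) (σ δ : ℝ)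
    (h₁ : ∀ K, D.stageVol₁ x₀ x₁ σ δ K ≠ 0) (h₂ : ∀ K, D.stageVol₂ x₀ x₁ σ δ K ≠ 0)
    (h₃ : ∀ K, D.stageVol₃ x₀ x₁ σ δ K ≠ 0) (q : T → Poly) :
    D.interpStep k post x₀ x₁ σ δ (a • q) = a • D.interpStep k post x₀ x₁ σ δ q := by
  have hstage : ∀ {vol : T → ℝ} (_ : ∀ K, vol K ≠ 0) (ℓ ℓ' : T → Poly → ℝ)
      (_ : ∀ K φ, ℓ' K φ = a * ℓ K φ),
      (fun K => post (dgSolve k (vol K) (ℓ' K))) = a • fun K => post (dgSolve k (vol K) (ℓ K)) := by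
    intro vol hvol ℓ ℓ' h
    ext1 K
    rw [dgSolve_smul (hvol K) ha (h K), hpost]
    rfl
  unfold MeshTopology.interpStep
  extract_lets d vol₀ q₁' q₂' q₁ q₂
  have e₁ : q₁' = a • q₁ := by
    refine hstage h₁ _ _ fun K φ => ?_
    rw [interpRhs_smul, Pi.smul_apply, massForm_smul_left]
    ring
  have e₂ : q₂' = a • q₂ := by
    refine hstage h₂ _ _ fun K φ => ?_
    rw [e₁, interpRhs_smul, Pi.smul_apply, Pi.smul_apply, massForm_smul_left, massForm_smul_left]
    ring
  refine hstage h₃ _ _ fun K φ => ?_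
  rw [e₂, interpRhs_smul, Pi.smul_apply, Pi.smul_apply, massForm_smul_left, massForm_smul_left]
  ring

/-- One pseudo-time step preserves constants, because the element volumes obey the geometric
conservation law at each stage. -/
theorem interpStep_const (D : MeshTopology V T) (k : ℕ) (x₀ x₁ : V → Pt) (σ δ : ℝ)
    (h₁ : ∀ K, D.stageVol₁ x₀ x₁ σ δ K ≠ 0) (h₂ : ∀ K, D.stageVol₂ x₀ x₁ σ δ K ≠ 0)
    (h₃ : ∀ K, D.stageVol₃ x₀ x₁ σ δ K ≠ 0)
    (hj₁ : ∀ K, jac (D.tri (posAt x₀ x₁ σ) K) ≠ 0)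
    (hj₂ : ∀ K, jac (D.tri (posAt x₀ x₁ (σ + δ)) K) ≠ 0)
    (hj₃ : ∀ K, jac (D.tri (posAt x₀ x₁ (σ + δ / 2)) K) ≠ 0) (a : ℝ) :
    D.interpStep k id x₀ x₁ σ δ (fun _ => C a) = fun _ => C a := by
  unfold MeshTopology.interpStep
  extract_lets d vol₀ q₁ q₂
  have e₁ : q₁ = fun _ => C a := by
    ext1 K
    refine dgSolve_eq (h₁ K) (C_mem_Pk k a) fun φ _ => ?_
    rw [interpRhs_const D d (hj₁ K), MeshTopology.stageVol₁, massForm_vol_add, massForm_vol]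
  have e₂ : q₂ = fun _ => C a := by
    ext1 K
    refine dgSolve_eq (h₂ K) (C_mem_Pk k a) fun φ _ => ?_
    rw [e₁, interpRhs_const D d (hj₂ K), MeshTopology.stageVol₂]
    simp only [massForm_vol_add, massForm_vol, vol₀, d]
  ext1 K
  refine dgSolve_eq (h₃ K) (C_mem_Pk k a) fun φ _ => ?_
  rw [e₂, interpRhs_const D d (hj₃ K), MeshTopology.stageVol₃]
  simp only [massForm_vol_add, massForm_vol, vol₀, d]

theorem PseudoTime.le_of_le (P : PseudoTime) {ν μ : ℕ} (h : ν ≤ μ) (hμ : μ ≤ P.N) :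
    P.ς ν ≤ P.ς μ := by
  induction μ, h using Nat.le_induction with
  | base => exact le_rfl
  | succ μ _ ih => exact (ih (by omega)).trans (P.increasing μ (by omega)).le

theorem PseudoTime.mem_Icc (P : PseudoTime) {ν : ℕ} (h : ν ≤ P.N) :
    P.ς ν ∈ Set.Icc (0 : ℝ) 1 :=
  ⟨P.start ▸ P.le_of_le (Nat.zero_le ν) h, P.finish ▸ P.le_of_le h le_rfl⟩

theorem PseudoTime.N_pos (P : PseudoTime) : 0 < P.N := by
  refine Nat.pos_of_ne_zero fun h => ?_
  have h0 := P.start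
  have h1 := P.finish
  rw [h, h0] at h1
  exact zero_ne_one h1

section Admissible

variable {D : MeshTopology V T} {x₀ x₁ : V → Pt} {P : PseudoTime}

theorem MeshTopology.Admissible.jac_ne_zero (hP : D.Admissible x₀ x₁ P) {σ : ℝ}
    (hσ : σ ∈ Set.Icc (0 : ℝ) 1) (K : T) : jac (D.tri (posAt x₀ x₁ σ) K) ≠ 0 :=
  ((hP.not_tangled σ hσ).jac_pos K).ne'

theorem MeshTopology.Admissible.stageVol₃_ne_zero (hP : D.Admissible x₀ x₁ P) {ν : ℕ}
    (hν : ν < P.N) (K : T) :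
    D.stageVol₃ x₀ x₁ (P.ς ν) (P.ς (ν + 1) - P.ς ν) K ≠ 0 := by
  rw [stageVol₃_eq, add_sub_cancel, area]
  exact div_ne_zero (hP.jac_ne_zero (P.mem_Icc hν) K) two_ne_zero

theorem interpIter_smul (hP : D.Admissible x₀ x₁ P) (k : ℕ) {post : Poly → Poly} {a : ℝ}
    (ha : a ≠ 0) (hpost : ∀ q, post (a • q) = a • post q) (q : T → Poly) {ν : ℕ} (hν : ν ≤ P.N) :
    D.interpIter k post x₀ x₁ P (a • q) ν = a • D.interpIter k post x₀ x₁ P q ν := by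
  induction ν with
  | zero => rfl
  | succ ν ih =>
    simp only [MeshTopology.interpIter]
    rw [ih (by omega), interpStep_smul D k ha hpost _ _ _ _ (fun K => (hP.vol₁_pos ν hν K).ne')
      (fun K => (hP.vol₂_pos ν hν K).ne') (hP.stageVol₃_ne_zero hν)]

theorem dgInterp_const (hP : D.Admissible x₀ x₁ P) (S : Scheme) (a : ℝ) :
    D.dgInterp S x₀ x₁ P (fun _ => C a) = fun _ => C a := by
  suffices h : ∀ ν ≤ P.N, D.interpIter S.k id x₀ x₁ P (fun _ => C a) ν = fun _ => C a from
    h P.N le_rfl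
  intro ν hν
  induction ν with
  | zero => rfl
  | succ ν ih =>
    have hσ := P.mem_Icc (ν := ν) (by omega)
    have hσ' := P.mem_Icc hν
    rw [MeshTopology.interpIter, ih (by omega)]
    refine interpStep_const D S.k _ _ _ _ (fun K => (hP.vol₁_pos ν hν K).ne')
      (fun K => (hP.vol₂_pos ν hν K).ne') (hP.stageVol₃_ne_zero hν) (hP.jac_ne_zero hσ)
      (hP.jac_ne_zero ?_) (hP.jac_ne_zero ?_) a
    · rwa [add_sub_cancel]
    · exact ⟨by linarith [hσ.1, hσ'.1], by linarith [hσ.2, hσ'.2]⟩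

theorem ppDgInterp_smul (hP : D.Admissible x₀ x₁ P) (S : Scheme) {a : ℝ} (ha : 0 < a)
    (q : T → Poly) : D.ppDgInterp S x₀ x₁ P (a • q) = a • D.ppDgInterp S x₀ x₁ P q :=
  interpIter_smul hP S.k ha.ne' (ppScale_smul S ha) q le_rfl

end Admissible

/-- The last operation of the interpolation is the limiter, so its result is a fixed point of the
limiter. -/
theorem ppScale_ppDgInterp (D : MeshTopology V T) (S : Scheme) (x₀ x₁ : V → Pt) (P : PseudoTime)
    (q : T → Poly) (K : T) :
    S.ppScale (D.ppDgInterp S x₀ x₁ P q K) = D.ppDgInterp S x₀ x₁ P q K := by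
  obtain ⟨ν, hν⟩ := Nat.exists_eq_succ_of_ne_zero P.N_pos.ne'
  rw [MeshTopology.ppDgInterp, hν]
  exact ppScale_ppScale S _

/-- A lake at rest which the positivity-preserving limiter does not change. -/
structure Config.IsLimitedAtRest (S : Scheme) (C₁ C₂ : ℝ) (c : Config T) : Prop where
  inDG : c.InDG S.k
  lake : c.IsLakeAtRest C₁ C₂
  limited : ∀ K, S.ppScale (c.U 0 K) = c.U 0 K

theorem isLimitedAtRest_remap {D : MeshTopology V T} {S : Scheme} {x₀ x₁ : V → Pt} {P : PseudoTime}
    (hP : D.Admissible x₀ x₁ P) {C₁ C₂ : ℝ} (hC₁ : 0 < C₁) {c : Config T} (hc : c.InDG S.k)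
    (hlake : c.IsLakeAtRest C₁ C₂) : (D.remap S x₀ x₁ P c).IsLimitedAtRest S C₁ C₂ := by
  have h1 : c.U 1 = fun _ => C 0 := funext fun K => by rw [hlake.m_eq, C_0]
  have h2 : c.U 2 = fun _ => C 0 := funext fun K => by rw [hlake.w_eq, C_0]
  have h3 : c.U 3 = C₁ • c.U 0 := funext hlake.eta_eq
  have h4 : c.U 0 + c.b = fun _ => C C₂ := funext hlake.surface_eq
  have hm : ∀ K, (D.remap S x₀ x₁ P c).U 1 K = 0 := by
    intro K
    change D.dgInterp S x₀ x₁ P (c.U 1) K = 0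
    rw [h1, dgInterp_const hP, C_0]
  have hw : ∀ K, (D.remap S x₀ x₁ P c).U 2 K = 0 := by
    intro K
    change D.dgInterp S x₀ x₁ P (c.U 2) K = 0
    rw [h2, dgInterp_const hP, C_0]
  have hη : ∀ K, (D.remap S x₀ x₁ P c).U 3 K = C₁ • (D.remap S x₀ x₁ P c).U 0 K := by
    intro K
    simp [MeshTopology.remap, h3, ppDgInterp_smul hP S hC₁]
  have hb : ∀ K, (D.remap S x₀ x₁ P c).b K = C C₂ - (D.remap S x₀ x₁ P c).U 0 K := by
    intro K
    simp [MeshTopology.remap, h4, dgInterp_const hP]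
  have hh : ∀ K, (D.remap S x₀ x₁ P c).U 0 K ∈ Pk S.k := fun K =>
    interpIter_mem D (fun _ h => ppScale_mem S h) x₀ x₁ P (hc.1 0) P.N K
  refine ⟨⟨fun i K => ?_, fun K => ?_⟩, ⟨hm, hw, hη, fun K => ?_⟩,
    ppScale_ppDgInterp D S x₀ x₁ P (c.U 0)⟩
  · fin_cases i
    · exact hh K
    · exact (hm K).symm ▸ Submodule.zero_mem _
    · exact (hw K).symm ▸ Submodule.zero_mem _
    · exact (hη K).symm ▸ Submodule.smul_mem _ _ (hh K)
  · exact (hb K).symm ▸ Submodule.sub_mem _ (C_mem_Pk _ _) (hh K)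
  · rw [hb, add_sub_cancel]

/-! ### The discretization of the Ripa model at a lake at rest -/

/-- Point values of a lake at rest with `η = C₁ h`. -/
def lakeState (C₁ h : ℝ) : Fin 4 → ℝ := ![h, 0, 0, C₁ * h]

theorem vel_lakeState (S : Scheme) (C₁ h : ℝ) : S.vel (lakeState C₁ h) = 0 := by
  have h0 : (![(0 : ℝ), 0] : Pt) = 0 := by ext i; fin_cases i <;> rfl
  unfold Scheme.vel
  split
  · simp [lakeState, h0]
  · split_ifs
    · rfl
    · simp [lakeState, h0]

theorem mirror_lakeState (n : Pt) (C₁ h : ℝ) : mirror n (lakeState C₁ h) = lakeState C₁ h := by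
  simp [mirror, lakeState]

/-- In a lake at rest only the pressure contributes to the flux. -/
theorem fluxN_lakeState (S : Scheme) (n : Pt) (C₁ h : ℝ) : S.fluxN n (lakeState C₁ h)
    = ![0, 1 / 2 * S.g * C₁ * (h * h) * n 0, 1 / 2 * S.g * C₁ * (h * h) * n 1, 0] := by
  ext i
  simp only [Scheme.fluxN, Scheme.flux, vel_lakeState]
  fin_cases i <;>
    simp only [Fin.zero_eta, Fin.mk_one, Fin.reduceFinMk, Pi.zero_apply, lakeState,
      Matrix.cons_val] <;>
    ring

/-- The hypothesis `hdry` accounts for the quotient `η / h` being read as `0` where `h = 0`: there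
the reconstructed depth has to vanish too. -/
theorem reconst_lakeState (S : Scheme) (C₁ : ℝ) {C₂ h b bs : ℝ} (hb : h + b = C₂)
    (hdry : h = 0 → C₂ ≤ bs) :
    S.reconst (lakeState C₁ h) b bs = lakeState C₁ (max 0 (C₂ - bs)) := by
  have h0 : lakeState C₁ h 0 = h := rfl
  have h3 : lakeState C₁ h 3 = C₁ * h := rfl
  have hq : max 0 (C₂ - bs) * (C₁ * h / h) = C₁ * max 0 (C₂ - bs) := by
    by_cases hh : h = 0
    · rw [max_eq_left (sub_nonpos.2 (hdry hh)), zero_mul, mul_zero]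
    · rw [mul_div_cancel_right₀ _ hh, mul_comm]
  simp only [Scheme.reconst, vel_lakeState, h0, h3, hb, hq, Pi.zero_apply, mul_zero]
  rfl

theorem Config.IsLakeAtRest.b_eq {C₁ C₂ : ℝ} {c : Config T} (hc : c.IsLakeAtRest C₁ C₂) (K : T) :
    c.b K = C C₂ - c.U 0 K :=
  eq_sub_of_add_eq' (hc.surface_eq K)

theorem eval_lake {C₁ C₂ : ℝ} {c : Config T} (hc : c.IsLakeAtRest C₁ C₂)
    (K : T) (ξ : Pt) :
    (fun i => eval ξ (c.U i K)) = lakeState C₁ (eval ξ (c.U 0 K)) := by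
  ext i
  fin_cases i
  · rfl
  · simp [hc.m_eq, lakeState]
  · simp [hc.w_eq, lakeState]
  · simp [hc.eta_eq, lakeState]

theorem intState_lake {C₁ C₂ : ℝ} {c : Config T} (hc : c.IsLakeAtRest C₁ C₂)
    (K : T) (e : Fin 3) (s : ℝ) :
    intState c.U K e s = lakeState C₁ (intTrace (c.U 0) K e s) :=
  eval_lake hc K _

theorem extState_lake {C₁ C₂ : ℝ} {c : Config T} (hc : c.IsLakeAtRest C₁ C₂)
    (D : MeshTopology V T) (x : V → Pt) (K : T) (e : Fin 3) (s : ℝ) :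
    D.extState x c.U K e s = lakeState C₁ (D.extTrace (c.U 0) K e s) := by
  unfold MeshTopology.extState MeshTopology.extTrace
  cases D.link K e with
  | adjacent K' e' τ => exact intState_lake hc _ _ _
  | reflecting => simp only [intState_lake hc, mirror_lakeState]
  | outflow => exact intState_lake hc _ _ _

theorem intTrace_add_lake {C₁ C₂ : ℝ} {c : Config T} (hc : c.IsLakeAtRest C₁ C₂)
    (K : T) (e : Fin 3) (s : ℝ) :
    intTrace (c.U 0) K e s + intTrace c.b K e s = C₂ := by
  rw [intTrace, intTrace, ← map_add, hc.surface_eq, eval_C]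

theorem extTrace_add_lake {C₁ C₂ : ℝ} {c : Config T} (hc : c.IsLakeAtRest C₁ C₂)
    (D : MeshTopology V T) (K : T) (e : Fin 3) (s : ℝ) :
    D.extTrace (c.U 0) K e s + D.extTrace c.b K e s = C₂ := by
  unfold MeshTopology.extTrace
  cases D.link K e <;> exact intTrace_add_lake hc _ _ _

theorem intStar_lake {C₁ C₂ : ℝ} {c : Config T} (hc : c.IsLakeAtRest C₁ C₂)
    (D : MeshTopology V T) (S : Scheme) (K : T) (e : Fin 3) (s : ℝ) :
    D.intStar S c K e s = lakeState C₁ (max 0 (C₂ - D.bStar c K e s)) := by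
  have h := intTrace_add_lake hc K e s
  rw [MeshTopology.intStar, intState_lake hc]
  refine reconst_lakeState S C₁ h fun h0 => ?_
  rw [← h, h0, zero_add]
  exact le_max_left _ _

theorem extStar_lake {C₁ C₂ : ℝ} {c : Config T} (hc : c.IsLakeAtRest C₁ C₂)
    (D : MeshTopology V T) (S : Scheme) (x : V → Pt) (K : T) (e : Fin 3) (s : ℝ) :
    D.extStar S x c K e s = lakeState C₁ (max 0 (C₂ - D.bStar c K e s)) := by
  have h := extTrace_add_lake hc D K e s
  rw [MeshTopology.extStar, extState_lake hc]
  refine reconst_lakeState S C₁ h fun h0 => ?_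
  rw [← h, h0, zero_add]
  exact le_max_right _ _

/-- The reconstructed states on the two sides of an edge agree, so the numerical flux is the exact
flux of the interior trace, whatever the Lax-Friedrichs coefficient. -/
theorem wbFlux_lake {C₁ C₂ : ℝ} {c : Config T} (hc : c.IsLakeAtRest C₁ C₂)
    (D : MeshTopology V T) (S : Scheme) (x : V → Pt) (K : T) (e : Fin 3) (s : ℝ)
    (i : Fin 4) : D.wbFlux S x c K e s i
      = S.fluxN (normal (D.tri x K) e) (lakeState C₁ (intTrace (c.U 0) K e s)) i := by
  simp only [MeshTopology.wbFlux, Scheme.lfFlux, intStar_lake hc, extStar_lake hc,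
    intState_lake hc]
  ring

theorem physGrad_b_lake {C₁ C₂ : ℝ} {c : Config T} (hc : c.IsLakeAtRest C₁ C₂)
    (p : Fin 3 → Pt) (K : T) (j : Fin 2) :
    physGrad p (c.b K) j = -physGrad p (c.U 0 K) j := by
  rw [hc.b_eq]
  fin_cases j <;> simp [physGrad] <;> ring

/-- Source term and pressure cancel: as `∇b = -∇h`, the residual is the defect in the divergence
theorem for {C₁ C₂ : ℝ} {c : Config T} (hc : c.IsLakeAtRest C₁ C₂)
    the polynomial `½ g C₁ h² φ`. -/
theorem pressure_balance {C₁ C₂ : ℝ} {c : Config T} (hc : c.IsLakeAtRest C₁ C₂)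
    {D : MeshTopology V T} (S : Scheme) {x : V → Pt} {K : T}
    (hK : jac (D.tri x K) ≠ 0) (φ : Poly) (j : Fin 2) :
    elemIntegral (D.tri x K) (fun ξ => -S.g * eval ξ (c.U 3 K)
        * eval ξ (physGrad (D.tri x K) (c.b K) j) * eval ξ φ)
      + elemIntegral (D.tri x K) (fun ξ => 1 / 2 * S.g * C₁ * (eval ξ (c.U 0 K) * eval ξ (c.U 0 K))
        * eval ξ (physGrad (D.tri x K) φ j))
      - ∑ e : Fin 3, edgeIntegral (D.tri x K) e
        (fun s => 1 / 2 * S.g * C₁ * (intTrace (c.U 0) K e s * intTrace (c.U 0) K e s)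
          * normal (D.tri x K) e j * intTrace (fun _ => φ) K e s) = 0 := by
  have h1 : (fun ξ => -S.g * eval ξ (c.U 3 K)
        * eval ξ (physGrad (D.tri x K) (c.b K) j) * eval ξ φ)
      = fun ξ => (S.g * C₁ / 2) *
        eval ξ (physGrad (D.tri x K) (c.U 0 K * c.U 0 K) j * φ) := by
    ext ξ
    simp only [hc.eta_eq, physGrad_b_lake hc, physGrad_mul, map_mul, map_add, map_neg, smul_eval]
    ring
  have h2 : (fun ξ => 1 / 2 * S.g * C₁ * (eval ξ (c.U 0 K) * eval ξ (c.U 0 K))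
        * eval ξ (physGrad (D.tri x K) φ j))
      = fun ξ => (S.g * C₁ / 2) *
        eval ξ (c.U 0 K * c.U 0 K * physGrad (D.tri x K) φ j) := by
    ext ξ
    simp only [map_mul]
    ring
  have h3 : ∀ e, edgeIntegral (D.tri x K) e
        (fun s => 1 / 2 * S.g * C₁ * (intTrace (c.U 0) K e s * intTrace (c.U 0) K e s)
          * normal (D.tri x K) e j * intTrace (fun _ => φ) K e s)
      = (S.g * C₁ / 2) * (scaledNormal (D.tri x K) e j
        * edgeInt e (c.U 0 K * c.U 0 K * φ)) := by
    intro e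
    have : (fun s => 1 / 2 * S.g * C₁ * (intTrace (c.U 0) K e s * intTrace (c.U 0) K e s)
          * normal (D.tri x K) e j * intTrace (fun _ => φ) K e s)
        = fun s => (S.g * C₁ / 2 * normal (D.tri x K) e j)
          * eval (edgePt e s) (c.U 0 K * c.U 0 K * φ) := by
      ext s
      simp only [map_mul, intTrace]
      ring
    rw [this, edgeIntegral_const_mul, edgeIntegral, integral_eval_edgePt, ← len_mul_normal]
    ring
  rw [h1, h2, elemIntegral_const_mul, elemIntegral_const_mul, elemIntegral_eval,
    elemIntegral_eval]
  simp only [h3, ← Finset.mul_sum, ← integration_by_parts hK]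
  ring

theorem residual_lake {C₁ C₂ : ℝ} {c : Config T} (hc : c.IsLakeAtRest C₁ C₂)
    {D : MeshTopology V T} (S : Scheme) {x : V → Pt} {K : T}
    (hK : jac (D.tri x K) ≠ 0) (i : Fin 4) (φ : Poly) : D.residual S x c K i φ = 0 := by
  have hcont : (∀ ξ, D.source S x c K ξ i = 0) → (∀ n h, S.fluxN n (lakeState C₁ h) i = 0) →
      D.residual S x c K i φ = 0 := by
    intro hs hf
    simp [MeshTopology.residual, wbFlux_lake hc, eval_lake hc, hs, hf, elemIntegral, refIntegral,
      edgeIntegral]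
  fin_cases i
  · exact hcont (fun _ => rfl) fun _ _ => by rw [fluxN_lakeState]; rfl
  · rw [← pressure_balance hc S hK φ 0]
    simp only [MeshTopology.residual, wbFlux_lake hc, eval_lake hc, fluxN_lakeState]
    rfl
  · rw [← pressure_balance hc S hK φ 1]
    simp only [MeshTopology.residual, wbFlux_lake hc, eval_lake hc, fluxN_lakeState]
    rfl
  · exact hcont (fun _ => rfl) fun _ _ => by rw [fluxN_lakeState]; rfl

/-- A Runge-Kutta stage does not move a lake at rest. -/
theorem rkStage_lake {D : MeshTopology V T} {S : Scheme} {x : V → Pt}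
    (hx : ∀ K, jac (D.tri x K) ≠ 0) (dt a : ℝ) {C₁ C₂ : ℝ} {c : Config T} (hDG : c.InDG S.k)
    (hc : c.IsLakeAtRest C₁ C₂) : D.rkStage S x dt a c c = c := by
  have hU : (D.rkStage S x dt a c c).U = c.U := by
    ext1 i
    ext1 K
    refine dgSolve_eq (div_ne_zero (hx K) two_ne_zero) (hDG.1 i K) fun φ _ => ?_
    rw [residual_lake hc S (hx K), mul_zero, add_zero, ← add_mul, sub_add_cancel, one_mul]
    rfl
  calc D.rkStage S x dt a c c = ⟨(D.rkStage S x dt a c c).U, c.b⟩ := rfl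
    _ = c := by rw [hU]

/-! ### The limiters at a lake at rest -/

theorem p1Part_C (a : ℝ) : p1Part (C a) = C a := by
  refine dgSolve_eq (by norm_num) (C_mem_Pk 1 a) fun φ _ => ?_
  simp [massForm]

theorem ownSlope_C (a : ℝ) (e : Fin 3) : ownSlope (C a) e = 0 := by
  rw [ownSlope, p1Part_C, eval_C, avg_C, sub_self]

theorem tvbMinmod_zero (M d : ℝ) : tvbMinmod M 0 d = 0 := by
  simp [tvbMinmod, minmod]

theorem linearFrom_zero (a : ℝ) : linearFrom a (fun _ => 0) = C a := by
  simp [linearFrom, balance]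

/-- On an element where the limited variables are constant, all increments of the limiter vanish,
whatever the averages in the neighbours. -/
theorem charLimited_const (D : MeshTopology V T) (S : Scheme) (x : V → Pt)
    (U W : Fin 4 → T → Poly) {K : T} {a : Fin 4 → ℝ} (hW : ∀ l, W l K = C (a l)) (l : Fin 4) :
    D.charLimited S x U W l K = W l K := by
  have h : ∀ e, D.charSlope S x U W K e = 0 := by
    intro e
    have h0 : (fun l => ownSlope (W l K) e) = 0 := by
      ext l
      rw [hW, ownSlope_C, Pi.zero_apply]
    simp only [MeshTopology.charSlope, h0, Matrix.mulVec_zero, Pi.zero_apply, tvbMinmod_zero]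
    exact Matrix.mulVec_zero _
  simp only [MeshTopology.charLimited, h, Pi.zero_apply, linearFrom_zero, hW, avg_C]

theorem scalarLimited_const (D : MeshTopology V T) (S : Scheme) (x : V → Pt)
    (W : Fin 4 → T → Poly) {K : T} {l : Fin 4} {a : ℝ} (hW : W l K = C a) :
    D.scalarLimited S x W l K = W l K := by
  simp only [MeshTopology.scalarLimited, hW, ownSlope_C, tvbMinmod_zero, linearFrom_zero, avg_C]

/-- For a limited lake at rest the variables `(h + b, m, w, η + bθ)` are constant on each element.
An element of zero average depth is dry, and there `η + bθ` vanishes. -/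
theorem surfaceVars_lake {S : Scheme} {C₁ C₂ : ℝ} {c : Config T} (hc : c.IsLimitedAtRest S C₁ C₂)
    (K : T) : ∃ a : Fin 4 → ℝ, ∀ l, surfaceVars c l K = C (a l) := by
  suffices h : ∃ a, c.U 3 K + bTheta c K = C a by
    obtain ⟨a, ha⟩ := h
    refine ⟨![C₂, 0, 0, a], fun l => ?_⟩
    fin_cases l
    · exact hc.lake.surface_eq K
    · exact (hc.lake.m_eq K).trans C_0.symm
    · exact (hc.lake.w_eq K).trans C_0.symm
    · exact ha
  rw [bTheta, hc.lake.eta_eq, avg_smul]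
  by_cases h0 : avg (c.U 0 K) = 0
  · exact ⟨0, by simp [eq_zero_of_ppScale_eq (hc.limited K) h0, avg_eq]⟩
  · refine ⟨C₁ * C₂, ?_⟩
    rw [mul_div_cancel_right₀ _ h0, ← smul_add, hc.lake.surface_eq, MvPolynomial.smul_eq_C_mul,
      C_mul]

theorem tvbLimit_lake (D : MeshTopology V T) {S : Scheme} (x : V → Pt) {C₁ C₂ : ℝ} {c : Config T}
    (hc : c.IsLimitedAtRest S C₁ C₂) : D.tvbLimit S x c = c := by
  unfold MeshTopology.tvbLimit
  cases S.tvbMode with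
  | surface =>
    have hmod : ∀ l K, (if ∀ i, D.charLimited S x c.U (surfaceVars c) i K
          = p1Part (surfaceVars c i K) then surfaceVars c l K
        else D.charLimited S x c.U (surfaceVars c) l K) = surfaceVars c l K := by
      intro l K
      obtain ⟨a, ha⟩ := surfaceVars_lake hc K
      rw [charLimited_const D S x c.U _ ha, ite_self]
    have hU : (D.tvbSurface S x c).U = c.U := by
      simp only [MeshTopology.tvbSurface, hmod]
      ext1 l
      fin_cases l <;> simp [surfaceVars]
    calc D.tvbSurface S x c = ⟨(D.tvbSurface S x c).U, c.b⟩ := rfl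
      _ = c := by rw [hU]
  | nearlyDry =>
    have hU : (D.tvbNearlyDry S x c).U = c.U := by
      ext1 l
      ext1 K
      obtain ⟨a, ha⟩ := surfaceVars_lake hc K
      refine if_pos ?_
      rw [scalarLimited_const D S x _ (ha 0), ha, p1Part_C]
    calc D.tvbNearlyDry S x c = ⟨(D.tvbNearlyDry S x c).U, c.b⟩ := rfl
      _ = c := by rw [hU]

theorem ppLimit_lake {S : Scheme} {C₁ C₂ : ℝ} (hC₁ : 0 < C₁) {c : Config T}
    (hc : c.IsLimitedAtRest S C₁ C₂) : S.ppLimit c = c := by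
  have hU : (S.ppLimit c).U = c.U := by
    ext1 l
    ext1 K
    fin_cases l
    · exact hc.limited K
    · rfl
    · rfl
    · change S.ppScale (c.U 3 K) = c.U 3 K
      rw [hc.lake.eta_eq, ppScale_smul S hC₁, hc.limited]
  have hb : (S.ppLimit c).b = c.b := by
    ext1 K
    change c.b K - (S.ppScale (c.U 0 K) - c.U 0 K) = c.b K
    rw [hc.limited, sub_self, sub_zero]
  calc S.ppLimit c = ⟨(S.ppLimit c).U, (S.ppLimit c).b⟩ := rfl
    _ = c := by rw [hU, hb]

/-- All three stages of the time stepping reproduce a limited lake at rest. -/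
theorem rkMod_lake {D : MeshTopology V T} {S : Scheme} {x : V → Pt}
    (hx : ∀ K, jac (D.tri x K) ≠ 0) (dt : ℝ) {C₁ C₂ : ℝ} (hC₁ : 0 < C₁) {c : Config T}
    (hc : c.IsLimitedAtRest S C₁ C₂) (i : Fin 3) : D.rkMod S x dt c i = c := by
  fin_cases i <;>
    simp [MeshTopology.rkMod, rkStage_lake hx dt _ hc.inDG hc.lake, tvbLimit_lake D x hc,
      ppLimit_lake hC₁ hc]

end Ripa

theorem mainTheorem2 {V T : Type*} [Finite T] (D : Ripa.MeshTopology V T) (S : Ripa.Scheme)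
    (x₀ x₁ : V → Ripa.Pt) (P : Ripa.PseudoTime) (hP : D.Admissible x₀ x₁ P)
    (dt C₁ C₂ : ℝ) (hC₁ : 0 < C₁) (hC₂ : 0 < C₂)
    (c : Ripa.Config T) (hc : c.InDG S.k) (hlake : c.IsLakeAtRest C₁ C₂) :
    (D.mmdgStep S x₀ x₁ P dt c).InDG S.k ∧
    (D.mmdgStep S x₀ x₁ P dt c).IsLakeAtRest C₁ C₂ ∧
    ∀ (i : Fin 3) (K : T),
      S.ppFactor ((D.rkMod S x₁ dt (D.remap S x₀ x₁ P c) i).U 0 K) =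
        S.ppFactor ((D.rkMod S x₁ dt (D.remap S x₀ x₁ P c) i).U 3 K) := by
  have hr := Ripa.isLimitedAtRest_remap hP hC₁ hc hlake
  have hx : ∀ K, Ripa.jac (D.tri x₁ K) ≠ 0 := by
    have h1 : Ripa.posAt x₀ x₁ 1 = x₁ := by
      ext v
      simp [Ripa.posAt]
    exact h1 ▸ hP.jac_ne_zero (Set.right_mem_Icc.2 zero_le_one)
  have hstep : D.mmdgStep S x₀ x₁ P dt c = D.remap S x₀ x₁ P c := by
    rw [Ripa.MeshTopology.mmdgStep, Ripa.rkMod_lake hx dt hC₁ hr, Ripa.ppLimit_lake hC₁ hr]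
  rw [hstep]
  refine ⟨hr.inDG, hr.lake, fun i K => ?_⟩
  rw [Ripa.rkMod_lake hx dt hC₁ hr, hr.lake.eta_eq, Ripa.ppFactor_smul S hC₁]
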